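/- Let $(X,d)$ be a Gromov hyperbolic space, i.e. a geodesic metric space such that, for some $\delta\ge 0$, all geodesic triangles are $\delta$-thin ($X$ need not be proper), and let $\partial X$ be its Gromov boundary, the set of quasigeodesic rays modulo finite Hausdorff distance. Let $G$ be a group acting on $X$ by isometries. An element $g\in G$ is \emph{loxodromic} if its translation length $\tau(g)=\lim_{n\to\infty} d(g^n x,x)/n$ is positive (the limit exists and does not depend on $x\in X$); two loxodromic elements are \emph{independent} if they have no common fixed point on $\partial X$. A loxodromic element $h\in G$ is \emph{WPD} (in $G$) if for every $K\ge 0$ and every $x\in X$ there is an integer $M>0$ such that the set $$\{g\in G : d(x,gx)\le K \text{ and } d(h^M x, g h^M x)\le K\}$$ is finite. Let $\mu$ be a probability measure on $G$, and let $\Gamma_\mu$ be the semigroup generated by the support of $\mu$. Suppose that - $\mu$ is countable: its support is countable; - $\mu$ is non-elementary: $\Gamma_\mu$ contains two independent loxodromic elements; - $\mu$ is bounded: for some $x\in X$ the set $\{gx : g\in\operatorname{supp}\mu\}$ is bounded in $X$; - $\Gamma_\mu$ contains an element that is WPD in $G$. Let $g_1,g_2,\dots$ be independent random elements of $G$ with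 distribution $\mu$, and let $w_n=g_1g_2\cdots g_n$. Then there are constants $B>0$ and $0<c<1$ such that for every $n\ge 0$ $$\mathbb{P}(w_n \text{ is WPD})\ \ge\ 1-Bc^{\sqrt n}.$$ -/

import Mathlib

open MeasureTheory Filter
open scoped Topology NNReal ENNReal

noncomputable section

namespace WPD

section Hyperbolic

variable {X : Type*} [MetricSpace X]

/-- `s` is (the image of) a geodesic segment joining `x` to `y`. -/
def IsGeodesicSegment (x y : X) (s : Set X) : Prop :=
  ∃ γ : ℝ → X, γ 0 = x ∧ γ (dist x y) = y ∧
    (∀ a ∈ Set.Icc 0 (dist x y), ∀ b ∈ Set.Icc 0 (dist x y), dist (γ a) (γ b) = |a - b|) ∧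
    s = γ '' Set.Icc 0 (dist x y)

variable (X) in
/-- Gromov hyperbolic space: a geodesic metric space all of whose geodesic triangles are
`δ`-thin, for some `δ ≥ 0`. -/
structure IsGromovHyperbolic : Prop where
  geodesic : ∀ x y : X, ∃ s, IsGeodesicSegment x y s
  thin : ∃ δ : ℝ, 0 ≤ δ ∧ ∀ (x y z : X) (a b c : Set X),
    IsGeodesicSegment x y a → IsGeodesicSegment y z b → IsGeodesicSegment x z c →
    ∀ p ∈ a, ∃ q ∈ b ∪ c, dist p q ≤ δ

variable (X) in
/-- Quasigeodesic rays in `X`. -/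
def QuasigeodesicRay : Type _ :=
  {γ : ℝ≥0 → X // ∃ K C : ℝ, 1 ≤ K ∧ 0 ≤ C ∧ ∀ s t : ℝ≥0,
    dist s t / K - C ≤ dist (γ s) (γ t) ∧ dist (γ s) (γ t) ≤ K * dist s t + C}

variable (X) in
/-- Two quasigeodesic rays are asymptotic if their images are at finite Hausdorff distance. -/
def asymptoticSetoid : Setoid (QuasigeodesicRay X) where
  r γ η := Metric.hausdorffEDist (Set.range γ.1) (Set.range η.1) ≠ ⊤
  iseqv :=
    { refl := fun γ => by simp
      symm := fun {γ η} h => by rwa [Metric.hausdorffEDist_comm]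
      trans := fun {γ η ζ} h₁ h₂ =>
        ne_top_of_le_ne_top (ENNReal.add_ne_top.2 ⟨h₁, h₂⟩) Metric.hausdorffEDist_triangle }

variable (X) in
/-- The Gromov boundary: asymptote classes of quasigeodesic rays. -/
def GromovBoundary : Type _ := Quotient (asymptoticSetoid X)

end Hyperbolic

section Action

variable {G : Type*} [Group G] {X : Type*} [MetricSpace X] [MulAction G X] [IsIsometricSMul G X]

/-- The translate of a quasigeodesic ray by an isometry. -/
def QuasigeodesicRay.translate (g : G) (γ : QuasigeodesicRay X) : QuasigeodesicRay X :=
  ⟨fun t => g • γ.1 t, by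
    obtain ⟨K, C, hK, hC, h⟩ := γ.2
    exact ⟨K, C, hK, hC, fun s t => by simpa only [dist_smul] using h s t⟩⟩

/-- The action of an isometry on the Gromov boundary. -/
def boundaryMap (g : G) : GromovBoundary X → GromovBoundary X :=
  Quotient.map' (s₁ := asymptoticSetoid X) (s₂ := asymptoticSetoid X)
    (QuasigeodesicRay.translate g) (fun γ η h => by
      have e : ∀ ζ : QuasigeodesicRay X, Set.range (QuasigeodesicRay.translate g ζ).1 =
          (fun x : X => g • x) '' Set.range ζ.1 := fun ζ =>
        Set.range_comp (fun x : X => g • x) ζ.1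
      change Metric.hausdorffEDist _ _ ≠ ⊤
      rw [e, e, Metric.hausdorffEDist_image (isometry_smul X g)]
      exact h)

variable (X) in
/-- The fixed point set of `g` on the Gromov boundary. -/
def boundaryFix (g : G) : Set (GromovBoundary X) := {ξ | boundaryMap g ξ = ξ}

variable (X) in
/-- `g` is loxodromic if it has positive translation length
`τ = lim d(gⁿ x, x) / n` (a limit that does not depend on `x`). -/
def IsLoxodromic (g : G) : Prop :=
  ∃ τ : ℝ, 0 < τ ∧ ∀ x : X, Tendsto (fun n : ℕ => dist (g ^ n • x) x / n) atTop (𝓝 τ)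

variable (X) in
/-- Independent loxodromic elements: no common fixed point on the Gromov boundary. -/
def AreIndependentLoxodromic (g h : G) : Prop :=
  IsLoxodromic X g ∧ IsLoxodromic X h ∧ Disjoint (boundaryFix X g) (boundaryFix X h)

variable (G) in
/-- Joint coarse stabilizer of two points. -/
def jointCoarseStab (K : ℝ) (x y : X) : Set G :=
  {g | dist x (g • x) ≤ K ∧ dist y (g • y) ≤ K}

variable (X) in
/-- `h` is a WPD element of `G`, for the action of `G` on `X`. -/
def IsWPD (h : G) : Prop :=
  IsLoxodromic X h ∧ ∀ K : ℝ, 0 ≤ K → ∀ x : X, ∃ M : ℕ, 0 < M ∧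
    (jointCoarseStab G K x (h ^ M • x)).Finite

end Action

section Walk

variable {G : Type*} [Group G] [MeasurableSpace G]

/-- The support of a discrete measure: the set of its atoms. -/
def atoms (μ : Measure G) : Set G := {g | μ {g} ≠ 0}

/-- `μ` is countable: it is carried by a countable set. -/
def IsCountableMeasure (μ : Measure G) : Prop := ∃ S : Set G, S.Countable ∧ μ Sᶜ = 0

/-- The semigroup `Γ_μ` generated by the support of `μ`. -/
def supportSemigroup (μ : Measure G) : Subsemigroup G := Subsemigroup.closure (atoms μ)

section

variable (X : Type*) [MetricSpace X] [MulAction G X] [IsIsometricSMul G X]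

def IsNonElementary (μ : Measure G) : Prop :=
  ∃ g ∈ supportSemigroup μ, ∃ h ∈ supportSemigroup μ, AreIndependentLoxodromic X g h

def IsBoundedMeasure (μ : Measure G) : Prop :=
  ∃ x : X, Bornology.IsBounded ((fun g : G => g • x) '' atoms μ)

/-- `Γ_μ` contains an element that is WPD in `G`. -/
def IsWPDMeasure (μ : Measure G) : Prop := ∃ h ∈ supportSemigroup μ, IsWPD X h

end

/-- The law of a sequence of independent steps with distribution `μ`. -/
def stepLaw (μ : Measure G) [IsProbabilityMeasure μ] : Measure (ℕ → G) :=
  Measure.infinitePi (fun _ : ℕ => μ)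

/-- The position `w_n = g₁ g₂ ⋯ g_n` of the random walk, where `g_{i+1} = ω i`. -/
def walk (ω : ℕ → G) : ℕ → G
  | 0 => 1
  | n + 1 => walk ω n * ω n

end Walk

end WPD

end

/-!
Outside an event of probability exponentially small in `√n`, the word `w_n` contains a subword
`s * h ^ M * s'` whose middle part is a large power of a WPD element and whose outer parts align it
with the rest of the word. Up to conjugation, `w_n` is then the translation along a periodic local
geodesic. Local geodesics are global, so `w_n` is loxodromic, and its axis follows a long segment of
the axis of `h`; an element which almost fixes two far apart points of the axis of `w_n` almost
fixes that segment, and only finitely many elements do.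

The alignment comes from Schottky families `s 0, s 1, …` of words in two independent loxodromic
elements: every point of `X` is behind at most one of the points `s i • o`, so that, for any given
past and future, a random member of the family is aligned with both with a probability bounded
below. For the same reason some power of `μ` moves the walk away from every given point on average,
and since the steps are bounded, `𝔼 exp (-ε d(y, w_n • o))` decays exponentially in `n`, uniformly
in `y` up to the factor `exp (-ε d(y, o))`.

Cut `w_n` into about `√n` blocks of length about `√n`, at the beginning of each of which there is a
chance bounded below of seeing an aligned subword. The attempts all fail with a probability
exponentially small in `√n`. By the exponential decay, it is equally unlikely that one of the
pieces into which `w_n` is cut is short compared with `√n`, or that two cyclically consecutive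
pieces backtrack by an amount comparable with `√n`.
-/

noncomputable section

namespace WPD

section GromovProduct

variable {X : Type*} [PseudoMetricSpace X]

/-- The Gromov product `(x | y)_w` of `x` and `y`; the base point `w` comes first. -/
def gromovProduct (w x y : X) : ℝ := (dist w x + dist w y - dist x y) / 2

lemma gromovProduct_comm (w x y : X) : gromovProduct w x y = gromovProduct w y x := by
  simp only [gromovProduct, dist_comm x y, add_comm]

lemma gromovProduct_nonneg (w x y : X) : 0 ≤ gromovProduct w x y := by
  have := dist_triangle_left x y w
  simp only [gromovProduct]; linarith

lemma gromovProduct_self_left (w y : X) : gromovProduct w w y = 0 := by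
  simp [gromovProduct]

lemma gromovProduct_self_right (w x : X) : gromovProduct w x w = 0 := by
  rw [gromovProduct_comm, gromovProduct_self_left]

lemma gromovProduct_add_gromovProduct (w x y : X) :
    gromovProduct w x y + gromovProduct x w y = dist w x := by
  simp only [gromovProduct, dist_comm x w]; ring

lemma gromovProduct_le_dist_left (w x y : X) : gromovProduct w x y ≤ dist w x := by
  linarith [gromovProduct_add_gromovProduct w x y, gromovProduct_nonneg x w y]

lemma gromovProduct_le_dist_right (w x y : X) : gromovProduct w x y ≤ dist w y := by
  rw [gromovProduct_comm]; exact gromovProduct_le_dist_left w y x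

lemma dist_sub_dist_le_gromovProduct (w x y : X) : dist w x - dist x y ≤ gromovProduct w x y := by
  linarith [gromovProduct_add_gromovProduct w x y, gromovProduct_le_dist_right x w y]

lemma dist_eq_add_sub_gromovProduct (w x y : X) :
    dist x y = dist w x + dist w y - 2 * gromovProduct w x y := by
  simp only [gromovProduct]; ring

lemma gromovProduct_le_add_base (w w' x y : X) :
    gromovProduct w x y ≤ gromovProduct w' x y + dist w w' := by
  have := dist_triangle w w' x
  have := dist_triangle w w' y
  simp only [gromovProduct]; linarith

lemma gromovProduct_le_add_left (w x x' y : X) :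
    gromovProduct w x y ≤ gromovProduct w x' y + dist x x' := by
  have := dist_triangle_right w x x'
  have := dist_triangle_left x' y x
  simp only [gromovProduct]; linarith

lemma gromovProduct_le_add_right (w x y y' : X) :
    gromovProduct w x y ≤ gromovProduct w x y' + dist y y' := by
  rw [gromovProduct_comm w x y, gromovProduct_comm w x y']
  exact gromovProduct_le_add_left w y y' x

variable (X) in
/-- Gromov's four-point form of `δ`-hyperbolicity, which involves no geodesics. -/
def FourPointCondition (δ : ℝ) : Prop :=
  ∀ w x y z : X, min (gromovProduct w x y) (gromovProduct w y z) ≤ gromovProduct w x z + δ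

variable {δ : ℝ}

lemma FourPointCondition.nonneg (hδ : FourPointCondition X δ) (x : X) : 0 ≤ δ := by
  simpa [gromovProduct_self_left] using hδ x x x x

lemma FourPointCondition.gromovProduct_le_of_lt_left (hδ : FourPointCondition X δ) {w x y z : X}
    (h : gromovProduct w x z + δ < gromovProduct w x y) :
    gromovProduct w y z ≤ gromovProduct w x z + δ :=
  (min_le_iff.1 (hδ w x y z)).resolve_left h.not_ge

lemma FourPointCondition.gromovProduct_le_of_lt_right (hδ : FourPointCondition X δ) {w x y z : X}
    (h : gromovProduct w x z + δ < gromovProduct w y z) :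
    gromovProduct w x y ≤ gromovProduct w x z + δ :=
  (min_le_iff.1 (hδ w x y z)).resolve_right h.not_ge

lemma FourPointCondition.min_le (hδ : FourPointCondition X δ) (w x y z u : X) :
    min (gromovProduct w x y) (min (gromovProduct w y z) (gromovProduct w z u)) ≤
      gromovProduct w x u + 2 * δ := by
  have := hδ.nonneg w
  have hxyz := hδ w x y z
  have hxzu := hδ w x z u
  grind

end GromovProduct

section Geodesic

variable {X : Type*} [MetricSpace X] {x y z p w : X} {s a b : Set X}

lemma IsGeodesicSegment.dist_add_dist (hs : IsGeodesicSegment x y s) (hp : p ∈ s) :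
    dist x p + dist p y = dist x y := by
  obtain ⟨γ, h0, h1, hγ, rfl⟩ := hs
  obtain ⟨t, ht, rfl⟩ := hp
  have hxp := hγ 0 (by simp) t ht
  have hpy := hγ t ht (dist x y) (by simp)
  rw [h0, zero_sub, abs_neg, abs_of_nonneg ht.1] at hxp
  rw [h1, abs_sub_comm, abs_of_nonneg (sub_nonneg.2 ht.2)] at hpy
  rw [hxp, hpy]; ring

lemma IsGeodesicSegment.left_mem (hs : IsGeodesicSegment x y s) : x ∈ s := by
  obtain ⟨γ, h0, -, -, rfl⟩ := hs
  exact ⟨0, by simp, h0⟩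

lemma IsGeodesicSegment.right_mem (hs : IsGeodesicSegment x y s) : y ∈ s := by
  obtain ⟨γ, -, h1, -, rfl⟩ := hs
  exact ⟨dist x y, by simp, h1⟩

lemma IsGeodesicSegment.isPreconnected (hs : IsGeodesicSegment x y s) : IsPreconnected s := by
  obtain ⟨γ, -, -, hγ, rfl⟩ := hs
  have : LipschitzOnWith 1 γ (Set.Icc 0 (dist x y)) :=
    .of_dist_le_mul fun a ha b hb => by rw [hγ a ha b hb, NNReal.coe_one, one_mul, Real.dist_eq]
  exact isPreconnected_Icc.image γ this.continuousOn

lemma IsGeodesicSegment.exists_dist_eq (hs : IsGeodesicSegment x y s) {r : ℝ} (h0 : 0 ≤ r)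
    (hr : r ≤ dist x y) : ∃ p ∈ s, dist x p = r := by
  obtain ⟨γ, hγ0, -, hγ, rfl⟩ := hs
  refine ⟨γ r, ⟨r, ⟨h0, hr⟩, rfl⟩, ?_⟩
  rw [← hγ0, hγ 0 (by simp) r ⟨h0, hr⟩, zero_sub, abs_neg, abs_of_nonneg h0]

lemma IsGeodesicSegment.gromovProduct_le_dist (hs : IsGeodesicSegment x y s) (hp : p ∈ s) (w : X) :
    gromovProduct w x y ≤ dist w p := by
  have := hs.dist_add_dist hp
  have := dist_triangle_right w x p
  have := dist_triangle w p y
  simp only [gromovProduct]; linarith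

/-- By connectedness, some point of the side opposite to `w` is close to both other sides. -/
lemma IsGeodesicSegment.exists_dist_le_gromovProduct_add {δ δ' : ℝ} (hs : IsGeodesicSegment y z s)
    (ha : IsGeodesicSegment z w a) (hb : IsGeodesicSegment y w b) (hδ : 0 ≤ δ) (hδ' : δ < δ')
    (thin : ∀ p ∈ s, ∃ q ∈ a ∪ b, dist p q ≤ δ) :
    ∃ p ∈ s, dist w p ≤ gromovProduct w y z + 2 * δ' := by
  have hcover : s ⊆ Metric.thickening δ' a ∪ Metric.thickening δ' b := fun p hp => by
    obtain ⟨q, hq | hq, hpq⟩ := thin p hp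
    · exact .inl (Metric.mem_thickening_iff.2 ⟨q, hq, hpq.trans_lt hδ'⟩)
    · exact .inr (Metric.mem_thickening_iff.2 ⟨q, hq, hpq.trans_lt hδ'⟩)
  have hδ'0 : 0 < δ' := hδ.trans_lt hδ'
  obtain ⟨p, hp, hpa, hpb⟩ := hs.isPreconnected _ _ Metric.isOpen_thickening
    Metric.isOpen_thickening hcover
    ⟨z, hs.right_mem, Metric.self_subset_thickening hδ'0 a ha.left_mem⟩
    ⟨y, hs.left_mem, Metric.self_subset_thickening hδ'0 b hb.left_mem⟩
  obtain ⟨q, hq, hpq⟩ := Metric.mem_thickening_iff.1 hpa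
  obtain ⟨r, hr, hpr⟩ := Metric.mem_thickening_iff.1 hpb
  refine ⟨p, hp, ?_⟩
  have := ha.dist_add_dist hq
  have := hb.dist_add_dist hr
  have := hs.dist_add_dist hp
  have := dist_triangle w q p
  have := dist_triangle w r p
  have := dist_triangle p q z
  have := dist_triangle p r y
  simp only [gromovProduct, dist_comm] at *
  linarith

lemma IsGromovHyperbolic.exists_fourPointCondition (hX : IsGromovHyperbolic X) :
    ∃ δ, FourPointCondition X δ := by
  obtain ⟨δ, hδ, thin⟩ := hX.thin
  refine ⟨3 * (δ + 1), fun w x y z => ?_⟩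
  obtain ⟨xz, hxz⟩ := hX.geodesic x z
  obtain ⟨zy, hzy⟩ := hX.geodesic z y
  obtain ⟨xy, hxy⟩ := hX.geodesic x y
  obtain ⟨zw, hzw⟩ := hX.geodesic z w
  obtain ⟨xw, hxw⟩ := hX.geodesic x w
  obtain ⟨p, hp, hwp⟩ := hxz.exists_dist_le_gromovProduct_add hzw hxw hδ (lt_add_one δ)
    (thin x z w xz zw xw hxz hzw hxw)
  obtain ⟨q, hq, hpq⟩ := thin x z y xz zy xy hxz hzy hxy p hp
  have hwq := dist_triangle w p q
  obtain hq | hq := hq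
  · have := hzy.gromovProduct_le_dist hq w
    rw [gromovProduct_comm w z y] at this
    exact (min_le_right _ _).trans (by linarith)
  · have := hxy.gromovProduct_le_dist hq w
    exact (min_le_left _ _).trans (by linarith)

end Geodesic

section Chains

variable {X : Type*} [PseudoMetricSpace X]

/-- A local quasigeodesic: at each point the Gromov product of the two neighbours is controlled by
`c`, and every step is long compared with the bounds at its two ends. -/
structure IsChain (δ : ℝ) (x : ℕ → X) (c : ℕ → ℝ) : Prop where
  nonneg : ∀ i, 0 ≤ c i
  gromovProduct_le : ∀ i, gromovProduct (x (i + 1)) (x i) (x (i + 2)) ≤ c (i + 1)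
  le_dist : ∀ i, c i + c (i + 1) + 3 * δ + 1 ≤ dist (x i) (x (i + 1))

variable {δ : ℝ} {x : ℕ → X} {c : ℕ → ℝ}

lemma IsChain.gromovProduct_succ_le (hδ : FourPointCondition X δ) (h : IsChain δ x c) {i j : ℕ}
    (hij : i < j) : gromovProduct (x j) (x i) (x (j + 1)) ≤ c j + δ := by
  have := hδ.nonneg (x 0)
  induction j, hij using Nat.le_induction with
  | base => linarith [h.gromovProduct_le i]
  | succ j _ ih =>
    have hj := h.gromovProduct_le j
    have hsum := gromovProduct_add_gromovProduct (x j) (x (j + 1)) (x i)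
    rw [gromovProduct_comm] at ih
    have hlt : gromovProduct (x (j + 1)) (x j) (x (j + 2)) + δ <
        gromovProduct (x (j + 1)) (x j) (x i) := by
      linarith [h.le_dist j]
    linarith [hδ.gromovProduct_le_of_lt_left hlt]

lemma IsChain.gromovProduct_pred_le (hδ : FourPointCondition X δ) (h : IsChain δ x c) {i k : ℕ}
    (hik : i + 1 < k) : gromovProduct (x (i + 1)) (x i) (x k) ≤ c (i + 1) + δ := by
  have := hδ.nonneg (x 0)
  obtain ⟨m, hm⟩ := Nat.exists_eq_add_of_le' hik
  induction m generalizing i with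
  | zero =>
    obtain rfl : k = i + 2 := by omega
    linarith [h.gromovProduct_le i]
  | succ m ih =>
    have hi := h.gromovProduct_le i
    have hnext := ih (i := i + 1) (by omega) (by omega)
    have hsum := gromovProduct_add_gromovProduct (x (i + 1)) (x (i + 2)) (x k)
    have hlt : gromovProduct (x (i + 1)) (x i) (x (i + 2)) + δ <
        gromovProduct (x (i + 1)) (x k) (x (i + 2)) := by
      rw [gromovProduct_comm _ (x k)]
      linarith [h.le_dist (i + 1)]
    linarith [hδ.gromovProduct_le_of_lt_right hlt]

lemma IsChain.gromovProduct_le_of_lt (hδ : FourPointCondition X δ) (h : IsChain δ x c) {i j k : ℕ}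
    (hij : i < j) (hjk : j < k) : gromovProduct (x j) (x i) (x k) ≤ c j + 2 * δ := by
  have := hδ.nonneg (x 0)
  have hleft := h.gromovProduct_succ_le hδ hij
  obtain rfl | hjk := (Nat.succ_le_of_lt hjk).eq_or_lt
  · linarith
  have hright := h.gromovProduct_pred_le hδ hjk
  have hsum := gromovProduct_add_gromovProduct (x j) (x (j + 1)) (x k)
  have hlt : gromovProduct (x j) (x i) (x (j + 1)) + δ <
      gromovProduct (x j) (x k) (x (j + 1)) := by
    rw [gromovProduct_comm _ (x k)]
    linarith [h.le_dist j]
  linarith [hδ.gromovProduct_le_of_lt_right hlt]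

lemma IsChain.le_dist_add (hδ : FourPointCondition X δ) (h : IsChain δ x c) (i k : ℕ) :
    c (i + k) - c i + k ≤ dist (x i) (x (i + k)) := by
  have := hδ.nonneg (x 0)
  induction k with
  | zero => simp
  | succ k ih =>
    have hstep := h.le_dist (i + k)
    obtain rfl | hk := Nat.eq_zero_or_pos k
    · have := h.nonneg i
      simp only [add_zero, zero_add, Nat.cast_one] at *
      linarith
    have hgp := h.gromovProduct_succ_le hδ (Nat.lt_add_of_pos_right (n := i) hk)
    have hdist := dist_eq_add_sub_gromovProduct (x (i + k)) (x i) (x (i + k + 1))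
    rw [dist_comm (x (i + k)) (x i)] at hdist
    rw [← add_assoc, Nat.cast_succ]
    linarith

end Chains

section Action

variable {G : Type*} [Group G] {X : Type*} [PseudoMetricSpace X] [MulAction G X]
  [IsIsometricSMul G X]

lemma gromovProduct_smul (g : G) (w x y : X) :
    gromovProduct (g • w) (g • x) (g • y) = gromovProduct w x y := by
  simp only [gromovProduct, dist_smul]

lemma gromovProduct_smul_base (g : G) (w x y : X) :
    gromovProduct (g • w) x y = gromovProduct w (g⁻¹ • x) (g⁻¹ • y) := by
  rw [← gromovProduct_smul g w, smul_inv_smul, smul_inv_smul]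

lemma dist_inv_smul (g : G) (x y : X) : dist (g⁻¹ • x) y = dist x (g • y) := by
  rw [← dist_smul g, smul_inv_smul]

lemma dist_inv_smul_self (g : G) (o : X) : dist o (g⁻¹ • o) = dist o (g • o) := by
  rw [dist_comm, dist_inv_smul]

lemma dist_mul_smul_le (o : X) (g h : G) :
    dist o ((g * h) • o) ≤ dist o (g • o) + dist o (h • o) := by
  simpa only [mul_smul, dist_smul] using dist_triangle o (g • o) (g • h • o)

lemma dist_pow_smul_le (o : X) (g : G) (n : ℕ) : dist o (g ^ n • o) ≤ n * dist o (g • o) := by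
  induction n with
  | zero => simp
  | succ n ih =>
    have := dist_mul_smul_le o (g ^ n) g
    rw [pow_succ, Nat.cast_succ]
    linarith

lemma dist_pow_smul_pow_smul (o : X) (g : G) {i j : ℕ} (h : i ≤ j) :
    dist (g ^ i • o) (g ^ j • o) = dist o (g ^ (j - i) • o) := by
  rw [← pow_mul_pow_sub g h, mul_smul, dist_smul]

lemma subadditive_dist_pow_smul (o : X) (g : G) : Subadditive fun n : ℕ => dist (g ^ n • o) o :=
  fun m n => by simpa only [pow_add, dist_comm] using dist_mul_smul_le o (g ^ m) (g ^ n)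

lemma tendsto_dist_pow_smul_div (o : X) (g : G) :
    Tendsto (fun n : ℕ => dist (g ^ n • o) o / n) atTop (𝓝 (subadditive_dist_pow_smul o g).lim) :=
  (subadditive_dist_pow_smul o g).tendsto_lim
    ⟨0, by rintro _ ⟨n, rfl⟩; positivity⟩

lemma lim_mul_le_dist_pow_smul (o : X) (g : G) (n : ℕ) :
    (subadditive_dist_pow_smul o g).lim * n ≤ dist (g ^ n • o) o := by
  obtain rfl | hn := Nat.eq_zero_or_pos n
  · simp
  · rw [← le_div_iff₀ (by exact_mod_cast hn)]
    exact (subadditive_dist_pow_smul o g).lim_le_div ⟨0, by rintro _ ⟨n, rfl⟩; positivity⟩ hn.ne'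

lemma tendsto_dist_pow_smul_div_of_tendsto {x y : X} {g : G} {τ : ℝ}
    (h : Tendsto (fun n : ℕ => dist (g ^ n • x) x / n) atTop (𝓝 τ)) :
    Tendsto (fun n : ℕ => dist (g ^ n • y) y / n) atTop (𝓝 τ) := by
  refine tendsto_of_tendsto_of_dist h (squeeze_zero (fun _ => dist_nonneg) (fun n => ?_)
    (tendsto_const_div_atTop_nhds_zero_nat (2 * dist x y)))
  rw [Real.dist_eq, ← sub_div, abs_div, Nat.abs_cast]
  gcongr
  have hy := dist_triangle4 (g ^ n • y) (g ^ n • x) x y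
  have hx := dist_triangle4 (g ^ n • x) (g ^ n • y) y x
  rw [dist_smul, dist_comm y x] at *
  rw [abs_le]
  constructor <;> linarith

lemma walk_const (g : G) (n : ℕ) : walk (fun _ => g) n = g ^ n := by
  induction n with
  | zero => simp [walk]
  | succ n ih => rw [walk, ih, pow_succ]

lemma isChain_walk_smul {δ : ℝ} {o : X} {T : ℕ → G} {c : ℕ → ℝ} (hc : ∀ i, 0 ≤ c i)
    (hgp : ∀ i, gromovProduct o ((T i)⁻¹ • o) (T (i + 1) • o) ≤ c (i + 1))
    (hdist : ∀ i, c i + c (i + 1) + 3 * δ + 1 ≤ dist o (T i • o)) :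
    IsChain δ (fun i => walk T i • o) c where
  nonneg := hc
  gromovProduct_le i := by
    have hprev : walk T i • o = walk T (i + 1) • (T i)⁻¹ • o := by
      rw [walk, mul_smul, smul_inv_smul]
    have hnext : walk T (i + 2) • o = walk T (i + 1) • T (i + 1) • o := by
      rw [walk, mul_smul]
    rw [hprev, hnext, gromovProduct_smul]
    exact hgp i
  le_dist i := by
    rw [walk, mul_smul, dist_smul]
    exact hdist i

end Action

section Loxodromic

variable {G : Type*} [Group G] {X : Type*} [MetricSpace X] [MulAction G X]

lemma IsLoxodromic.tendsto_dist_pow_two_mul_sub {g : G} (hg : IsLoxodromic X g) (o : X) :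
    Tendsto (fun n : ℕ => dist o (g ^ (2 * n) • o) - dist o (g ^ n • o)) atTop atTop := by
  obtain ⟨τ, hτ, hlim⟩ := hg
  have hlim2 := (hlim o).comp (tendsto_id.const_mul_atTop' (zero_lt_two' ℕ))
  have hslope := ((hlim2.const_mul 2).sub (hlim o)).pos_mul_atTop (by linarith)
    tendsto_natCast_atTop_atTop
  refine hslope.congr' ?_
  filter_upwards [eventually_ne_atTop 0] with n hn
  have : (n : ℝ) ≠ 0 := by exact_mod_cast hn
  simp only [Function.comp_apply, id_eq, Nat.cast_mul, Nat.cast_ofNat, dist_comm o]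
  field_simp

variable [IsIsometricSMul G X]

lemma isLoxodromic_of_linear_growth {o : X} {g : G} {κ C : ℝ} (hκ : 0 < κ)
    (h : ∀ n : ℕ, κ * n - C ≤ dist o (g ^ n • o)) : IsLoxodromic X g := by
  have hlim := tendsto_dist_pow_smul_div o g
  refine ⟨_, hκ.trans_le ?_, fun x => tendsto_dist_pow_smul_div_of_tendsto hlim⟩
  have hlow : Tendsto (fun n : ℕ => κ - C / n) atTop (𝓝 κ) := by
    simpa using tendsto_const_nhds.sub (tendsto_const_div_atTop_nhds_zero_nat C)
  refine le_of_tendsto_of_tendsto hlow hlim ?_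
  filter_upwards [eventually_gt_atTop 0] with n hn
  have hn : (0 : ℝ) < n := by exact_mod_cast hn
  rw [le_div_iff₀ hn, sub_mul, div_mul_cancel₀ _ hn.ne', dist_comm]
  exact h n

lemma IsLoxodromic.exists_linear_growth {g : G} (hg : IsLoxodromic X g) (o : X) :
    ∃ τ > 0, ∀ n : ℕ, τ * n ≤ dist o (g ^ n • o) := by
  obtain ⟨τ, hτ, hlim⟩ := hg
  obtain rfl := tendsto_nhds_unique (hlim o) (tendsto_dist_pow_smul_div o g)
  exact ⟨_, hτ, fun n => dist_comm o _ ▸ lim_mul_le_dist_pow_smul o g n⟩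

lemma IsLoxodromic.inv {g : G} (hg : IsLoxodromic X g) : IsLoxodromic X g⁻¹ := by
  obtain ⟨τ, hτ, hlim⟩ := hg
  exact ⟨τ, hτ, fun x => (hlim x).congr fun n => by rw [inv_pow, dist_inv_smul, dist_comm]⟩

lemma IsLoxodromic.exists_pow_isChain (δ : ℝ) {g : G} (hg : IsLoxodromic X g) (o : X) :
    ∃ N : ℕ, 0 < N ∧ ∃ c : ℝ, IsChain δ (fun i => (g ^ N) ^ i • o) fun _ => c := by
  obtain ⟨N, hN, hN0⟩ := ((hg.tendsto_dist_pow_two_mul_sub o).eventually_ge_atTop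
    (3 * δ + 1)).and (eventually_gt_atTop 0) |>.exists
  have hdouble : dist ((g ^ N)⁻¹ • o) (g ^ N • o) = dist o (g ^ (2 * N) • o) := by
    rw [dist_inv_smul, ← mul_smul, ← pow_add, two_mul]
  refine ⟨N, hN0, gromovProduct o ((g ^ N)⁻¹ • o) (g ^ N • o), ?_⟩
  simp only [← walk_const (g ^ N)]
  refine isChain_walk_smul (fun _ => gromovProduct_nonneg _ _ _) (fun _ => le_rfl) fun _ => ?_
  rw [gromovProduct, dist_inv_smul_self, hdouble]
  linarith

lemma dist_pow_smul_pow_pow_div_smul_le (o : X) (g : G) {N : ℕ} (hN : 0 < N) (i : ℕ) :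
    dist (g ^ i • o) ((g ^ N) ^ (i / N) • o) ≤ N * dist o (g • o) := by
  rw [dist_comm, ← pow_mul, dist_pow_smul_pow_smul o g (Nat.mul_div_le i N)]
  refine (dist_pow_smul_le o g _).trans ?_
  gcongr
  exact (Nat.mod_eq_sub_mul_div (k := N) (x := i) ▸ Nat.mod_lt i hN).le

lemma IsLoxodromic.exists_gromovProduct_pow_le {δ : ℝ} (hδ : FourPointCondition X δ) {g : G}
    (hg : IsLoxodromic X g) (o : X) :
    ∃ C, 0 ≤ C ∧ ∀ i n : ℕ, i ≤ n → gromovProduct (g ^ i • o) o (g ^ n • o) ≤ C := by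
  obtain ⟨N, hN, c, hchain⟩ := hg.exists_pow_isChain δ o
  have hδ0 := hδ.nonneg o
  have hc0 : 0 ≤ c := hchain.nonneg 0
  have hcoarse : ∀ r q : ℕ, r ≤ q →
      gromovProduct ((g ^ N) ^ r • o) o ((g ^ N) ^ q • o) ≤ c + 2 * δ := by
    intro r q hrq
    obtain rfl | hr := Nat.eq_zero_or_pos r
    · rw [pow_zero, one_smul, gromovProduct_self_left]; positivity
    obtain rfl | hrq := hrq.eq_or_lt
    · rw [gromovProduct_self_right]; positivity
    simpa using hchain.gromovProduct_le_of_lt hδ hr hrq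
  refine ⟨c + 2 * δ + 2 * (N * dist o (g • o)), by positivity, fun i n hin => ?_⟩
  have hbase := gromovProduct_le_add_base (g ^ i • o) ((g ^ N) ^ (i / N) • o) o (g ^ n • o)
  have hright := gromovProduct_le_add_right ((g ^ N) ^ (i / N) • o) o (g ^ n • o)
    ((g ^ N) ^ (n / N) • o)
  have := hcoarse (i / N) (n / N) (Nat.div_le_div_right hin)
  have := dist_pow_smul_pow_pow_div_smul_le o g hN i
  have := dist_pow_smul_pow_pow_div_smul_le o g hN n
  linarith

end Loxodromic

lemma hausdorffEDist_ne_top_of_dist_le {X : Type*} [PseudoMetricSpace X] {s t : Set X} {D : ℝ}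
    (hst : ∀ x ∈ s, ∃ y ∈ t, dist x y ≤ D) (hts : ∀ y ∈ t, ∃ x ∈ s, dist y x ≤ D) :
    Metric.hausdorffEDist s t ≠ ⊤ := by
  refine ne_top_of_le_ne_top (b := ENNReal.ofReal D) ENNReal.ofReal_ne_top
    (Metric.hausdorffEDist_le_of_mem_edist (fun x hx => ?_) fun y hy => ?_)
  · obtain ⟨y, hy, h⟩ := hst x hx
    exact ⟨y, hy, edist_dist x y ▸ ENNReal.ofReal_le_ofReal h⟩
  · obtain ⟨x, hx, h⟩ := hts y hy
    exact ⟨x, hx, edist_dist y x ▸ ENNReal.ofReal_le_ofReal h⟩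

lemma exists_quasigeodesic_bounds {X : Type*} [PseudoMetricSpace X] {x : ℕ → X} {τ A : ℝ}
    (hτ : 0 < τ)
    (hlow : ∀ i j : ℕ, i ≤ j → τ * ((j : ℝ) - i) ≤ dist (x i) (x j))
    (hup : ∀ i j : ℕ, i ≤ j → dist (x i) (x j) ≤ A * ((j : ℝ) - i)) :
    ∃ K C : ℝ, 1 ≤ K ∧ 0 ≤ C ∧ ∀ s t : ℝ≥0,
      dist s t / K - C ≤ dist (x ⌊s⌋₊) (x ⌊t⌋₊) ∧ dist (x ⌊s⌋₊) (x ⌊t⌋₊) ≤ K * dist s t + C := by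
  have hτA : τ ≤ A := by simpa using (hlow 0 1 zero_le_one).trans (hup 0 1 zero_le_one)
  have hinv := one_div_pos.2 hτ
  refine ⟨1 + 1 / τ + A, τ + A, by linarith, by linarith, fun s t => ?_⟩
  wlog hst : s ≤ t generalizing s t
  · rw [dist_comm s, dist_comm (x _)]
    exact this t s (le_of_not_ge hst)
  have hst' : (0 : ℝ) ≤ (t : ℝ) - s := sub_nonneg.2 (by exact_mod_cast hst)
  have hdist : dist s t = (t : ℝ) - s := by rw [NNReal.dist_eq, abs_sub_comm, abs_of_nonneg hst']
  have hfloor : ⌊s⌋₊ ≤ ⌊t⌋₊ := Nat.floor_mono hst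
  have hlow := hlow _ _ hfloor
  have hup := hup _ _ hfloor
  have hs₁ : ((⌊s⌋₊ : ℕ) : ℝ) ≤ s := Nat.floor_le s.2
  have ht₁ : ((⌊t⌋₊ : ℕ) : ℝ) ≤ t := Nat.floor_le t.2
  have hs₂ : (s : ℝ) < ⌊s⌋₊ + 1 := Nat.lt_floor_add_one (s : ℝ)
  have ht₂ : (t : ℝ) < ⌊t⌋₊ + 1 := Nat.lt_floor_add_one (t : ℝ)
  rw [hdist]
  constructor
  · have hslope : ((t : ℝ) - s) / (1 + 1 / τ + A) ≤ τ * (t - s) := by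
      rw [div_eq_mul_inv, mul_comm]
      gcongr
      rw [inv_le_comm₀ (by linarith) hτ, ← one_div]
      linarith
    nlinarith
  · have : 0 ≤ (1 + 1 / τ) * ((t : ℝ) - s) := by positivity
    nlinarith

section Boundary

variable {G : Type*} [Group G] {X : Type*} [MetricSpace X] [MulAction G X] [IsIsometricSMul G X]

/-- The quasigeodesic ray spanned by the nonnegative powers of a loxodromic element; it jumps from
`g ^ n • o` to `g ^ (n + 1) • o` at time `n + 1`. -/
def orbitRay {g : G} (hg : IsLoxodromic X g) (o : X) : QuasigeodesicRay X :=
  ⟨fun t => g ^ ⌊t⌋₊ • o, by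
    obtain ⟨τ, hτ, h⟩ := hg.exists_linear_growth o
    refine exists_quasigeodesic_bounds (x := fun n => g ^ n • o) (A := dist o (g • o)) hτ
      (fun i j hij => ?_) fun i j hij => ?_
    · simpa only [dist_pow_smul_pow_smul o g hij, Nat.cast_sub hij] using h (j - i)
    · simpa only [dist_pow_smul_pow_smul o g hij, Nat.cast_sub hij, mul_comm]
        using dist_pow_smul_le o g (j - i)⟩

lemma range_orbitRay {g : G} (hg : IsLoxodromic X g) (o : X) :
    Set.range (orbitRay hg o).1 = Set.range fun n : ℕ => g ^ n • o :=
  Function.Surjective.range_comp (fun n => ⟨n, Nat.floor_natCast n⟩ :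
    Function.Surjective fun t : ℝ≥0 => ⌊t⌋₊) fun n : ℕ => g ^ n • o

/-- The attracting fixed point on the boundary: the endpoint of the orbit of `o` under the positive
powers of the loxodromic element `g`. -/
def orbitEndpoint {g : G} (hg : IsLoxodromic X g) (o : X) : GromovBoundary X :=
  Quotient.mk (asymptoticSetoid X) (orbitRay hg o)

lemma orbitEndpoint_mem_boundaryFix {g : G} (hg : IsLoxodromic X g) (o : X) :
    orbitEndpoint hg o ∈ boundaryFix X g := by
  refine Quotient.sound (s := asymptoticSetoid X)
    (a := QuasigeodesicRay.translate g (orbitRay hg o)) ?_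
  change Metric.hausdorffEDist (Set.range ((g • ·) ∘ (orbitRay hg o).1)) _ ≠ ⊤
  rw [Set.range_comp, range_orbitRay, ← Set.range_comp]
  refine hausdorffEDist_ne_top_of_dist_le (D := dist o (g • o)) ?_ ?_
  · rintro _ ⟨n, rfl⟩
    refine ⟨_, ⟨n + 1, rfl⟩, ?_⟩
    simp only [Function.comp_apply, pow_succ', mul_smul, dist_self, dist_nonneg]
  · rintro _ ⟨n, rfl⟩
    refine ⟨_, ⟨n, rfl⟩, le_of_eq ?_⟩
    rw [Function.comp_apply, ← mul_smul, ← pow_succ', pow_succ, mul_smul, dist_smul]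

lemma boundaryMap_one_apply (ξ : GromovBoundary X) : boundaryMap (1 : G) ξ = ξ := by
  induction ξ using Quotient.inductionOn with
  | _ γ =>
    exact congrArg (Quotient.mk (asymptoticSetoid X))
      (Subtype.ext (funext fun t => one_smul G (γ.1 t)))

lemma boundaryMap_mul_apply (g h : G) (ξ : GromovBoundary X) :
    boundaryMap (g * h) ξ = boundaryMap g (boundaryMap h ξ) := by
  induction ξ using Quotient.inductionOn with
  | _ γ =>
    exact congrArg (Quotient.mk (asymptoticSetoid X))
      (Subtype.ext (funext fun t => mul_smul g h (γ.1 t)))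

lemma boundaryFix_subset_boundaryFix_inv (g : G) : boundaryFix X g ⊆ boundaryFix X g⁻¹ :=
  fun ξ hξ => by
    change boundaryMap g⁻¹ ξ = ξ
    nth_rw 1 [← show boundaryMap g ξ = ξ from hξ]
    rw [← boundaryMap_mul_apply, inv_mul_cancel, boundaryMap_one_apply]

lemma boundaryFix_inv (g : G) : boundaryFix X g⁻¹ = boundaryFix X g :=
  (by simpa using boundaryFix_subset_boundaryFix_inv g⁻¹ : boundaryFix X g⁻¹ ⊆ _).antisymm
    (boundaryFix_subset_boundaryFix_inv g)

end Boundary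

section Fellow

variable {G : Type*} [Group G] {X : Type*} [PseudoMetricSpace X] [MulAction G X]
  [IsIsometricSMul G X]

lemma exists_le_dist_pow_smul_le (o : X) (g : G) {r : ℝ} (hr : 0 ≤ r) {m : ℕ}
    (hm : r ≤ dist o (g ^ m • o)) :
    ∃ j ≤ m, r ≤ dist o (g ^ j • o) ∧ dist o (g ^ j • o) ≤ r + dist o (g • o) := by
  classical
  have hex : ∃ j, r ≤ dist o (g ^ j • o) := ⟨m, hm⟩
  refine ⟨Nat.find hex, Nat.find_min' hex hm, Nat.find_spec hex, ?_⟩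
  rcases hfind : Nat.find hex with _ | l
  · rw [pow_zero, one_smul, dist_self]
    positivity
  · have := not_le.1 (Nat.find_min hex (m := l) (by lia))
    have := dist_mul_smul_le o (g ^ l) g
    rw [pow_succ]
    linarith

/-- One compares the points of the two orbits at the same distance from `o`. -/
lemma exists_dist_pow_smul_le {δ : ℝ} (hδ : FourPointCondition X δ) {o : X} {a b : G} {A B : ℝ}
    (hA : ∀ i n : ℕ, i ≤ n → gromovProduct (a ^ i • o) o (a ^ n • o) ≤ A)
    (hB : ∀ i n : ℕ, i ≤ n → gromovProduct (b ^ i • o) o (b ^ n • o) ≤ B)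
    (hab : ∀ C : ℝ, ∃ n m : ℕ, C < gromovProduct o (a ^ n • o) (b ^ m • o)) (i : ℕ) :
    ∃ j : ℕ, dist (a ^ i • o) (b ^ j • o) ≤ dist o (b • o) + 2 * A + 2 * B + 4 * δ := by
  have := hδ.nonneg o
  have : 0 ≤ A := by simpa [gromovProduct_self_left] using hA 0 0 le_rfl
  have : 0 ≤ B := by simpa [gromovProduct_self_left] using hB 0 0 le_rfl
  obtain ⟨n, m, hnm⟩ := hab (i * dist o (a • o))
  have hai := dist_pow_smul_le o a i
  have hin : i ≤ n := by
    by_contra! hlt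
    have : (n : ℝ) * dist o (a • o) ≤ i * dist o (a • o) := by gcongr
    linarith [gromovProduct_le_dist_left o (a ^ n • o) (b ^ m • o), dist_pow_smul_le o a n]
  have hm : dist o (a ^ i • o) ≤ dist o (b ^ m • o) := by
    linarith [gromovProduct_le_dist_right o (a ^ n • o) (b ^ m • o)]
  obtain ⟨j, hjm, hj₁, hj₂⟩ := exists_le_dist_pow_smul_le o b dist_nonneg hm
  refine ⟨j, ?_⟩
  have hchain := hδ.min_le o (a ^ i • o) (a ^ n • o) (b ^ m • o) (b ^ j • o)
  have hsum_a := gromovProduct_add_gromovProduct o (a ^ i • o) (a ^ n • o)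
  have hsum_b := gromovProduct_add_gromovProduct o (b ^ j • o) (b ^ m • o)
  rw [gromovProduct_comm o (b ^ m • o) (b ^ j • o)] at hchain
  have hdist := dist_eq_add_sub_gromovProduct o (a ^ i • o) (b ^ j • o)
  have hAi := hA i n hin
  have hBj := hB j m hjm
  simp only [min_le_iff] at hchain
  obtain h | h | h := hchain <;> linarith

end Fellow

section Independent

variable {G : Type*} [Group G] {X : Type*} [MetricSpace X] [MulAction G X] [IsIsometricSMul G X]

lemma exists_gromovProduct_pow_pow_le {δ : ℝ} (hδ : FourPointCondition X δ) (o : X) {a b : G}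
    (ha : IsLoxodromic X a) (hb : IsLoxodromic X b)
    (hdisj : Disjoint (boundaryFix X a) (boundaryFix X b)) :
    ∃ C : ℝ, ∀ n m : ℕ, gromovProduct o (a ^ n • o) (b ^ m • o) ≤ C := by
  by_contra! hcon
  obtain ⟨A, _, hA⟩ := ha.exists_gromovProduct_pow_le hδ o
  obtain ⟨B, _, hB⟩ := hb.exists_gromovProduct_pow_le hδ o
  have hab := exists_dist_pow_smul_le hδ hA hB hcon
  have hba := exists_dist_pow_smul_le hδ hB hA fun C => by
    obtain ⟨n, m, h⟩ := hcon C
    exact ⟨m, n, by rwa [gromovProduct_comm]⟩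
  have hend : orbitEndpoint ha o = orbitEndpoint hb o := by
    refine Quotient.sound (s := asymptoticSetoid X) ?_
    change Metric.hausdorffEDist _ _ ≠ ⊤
    rw [range_orbitRay, range_orbitRay]
    have := hδ.nonneg o
    have : 0 ≤ dist o (a • o) := dist_nonneg
    have : 0 ≤ dist o (b • o) := dist_nonneg
    refine hausdorffEDist_ne_top_of_dist_le
      (D := dist o (a • o) + dist o (b • o) + 2 * A + 2 * B + 4 * δ) ?_ ?_
    · rintro _ ⟨n, rfl⟩
      obtain ⟨j, hj⟩ := hab n
      exact ⟨_, ⟨j, rfl⟩, hj.trans (by linarith)⟩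
    · rintro _ ⟨n, rfl⟩
      obtain ⟨j, hj⟩ := hba n
      exact ⟨_, ⟨j, rfl⟩, hj.trans (by linarith)⟩
  exact Set.disjoint_left.1 hdisj (orbitEndpoint_mem_boundaryFix ha o)
    (hend ▸ orbitEndpoint_mem_boundaryFix hb o)

lemma AreIndependentLoxodromic.exists_gromovProduct_zpow_zpow_le {δ : ℝ}
    (hδ : FourPointCondition X δ) (o : X) {a b : G} (h : AreIndependentLoxodromic X a b) :
    ∃ C : ℝ, ∀ m n : ℤ, gromovProduct o (a ^ m • o) (b ^ n • o) ≤ C := by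
  obtain ⟨ha, hb, hdisj⟩ := h
  obtain ⟨C₁, h₁⟩ := exists_gromovProduct_pow_pow_le hδ o ha hb hdisj
  obtain ⟨C₂, h₂⟩ := exists_gromovProduct_pow_pow_le hδ o ha.inv hb (by rwa [boundaryFix_inv])
  obtain ⟨C₃, h₃⟩ := exists_gromovProduct_pow_pow_le hδ o ha hb.inv (by rwa [boundaryFix_inv])
  obtain ⟨C₄, h₄⟩ := exists_gromovProduct_pow_pow_le hδ o ha.inv hb.inv
    (by rwa [boundaryFix_inv, boundaryFix_inv])
  refine ⟨max (max C₁ C₂) (max C₃ C₄), fun m n => ?_⟩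
  obtain ⟨m, rfl | rfl⟩ := m.eq_nat_or_neg <;> obtain ⟨n, rfl | rfl⟩ := n.eq_nat_or_neg <;>
    simp only [zpow_natCast, zpow_neg, ← inv_pow, le_max_iff, h₁ m n, h₂ m n, h₃ m n, h₄ m n,
      true_or, or_true]

end Independent

section Schottky

variable {G : Type*} [Group G] {X : Type*} [PseudoMetricSpace X] [MulAction G X]
  [IsIsometricSMul G X]

/-- A Schottky family: every point of `X` is in the direction of at most one of the `s i`, and of
at most one of the `(s i)⁻¹`, as seen from `o` with the threshold `C`, and the `s i` move `o` by
comparable amounts. -/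
structure IsSchottky {ι : Type*} (o : X) (C D : ℝ) (s : ι → G) : Prop where
  subsingleton (y : X) : {i | C < gromovProduct o y (s i • o)}.Subsingleton
  subsingleton_inv (y : X) : {i | C < gromovProduct o y ((s i)⁻¹ • o)}.Subsingleton
  le_dist (i : ι) : D ≤ dist o (s i • o)
  dist_le (i : ι) : dist o (s i • o) ≤ 2 * D

lemma gromovProduct_smul_self_le {δ C : ℝ} (hδ : FourPointCondition X δ) {o y : X} {g : G}
    (h₁ : gromovProduct o (g⁻¹ • o) y ≤ C) (h₂ : gromovProduct o (g • o) y ≤ C)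
    (hg : 2 * C + δ < dist o (g • o)) : gromovProduct o y (g • y) ≤ C + δ := by
  have hsum := gromovProduct_add_gromovProduct o (g • o) (g • y)
  rw [gromovProduct_smul_base, inv_smul_smul] at hsum
  rw [gromovProduct_comm o y]
  linarith [hδ.gromovProduct_le_of_lt_left (w := o) (x := g • o) (y := g • y) (z := y)
    (by linarith)]

lemma gromovProduct_zpow_conj_le {δ C E : ℝ} (hδ : FourPointCondition X δ) {o : X} {a b : G}
    {e e' f f' q : ℤ} (hC : ∀ m n : ℤ, gromovProduct o (a ^ m • o) (b ^ n • o) ≤ C)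
    (hdiff : 2 * C + δ < dist o (a ^ (e' - e) • o)) (he : dist o (a ^ e • o) ≤ E)
    (hf : dist o (a ^ f • o) ≤ E) (hf' : dist o (a ^ f' • o) ≤ E) :
    gromovProduct o ((a ^ e * b ^ q * a ^ f) • o) ((a ^ e' * b ^ q * a ^ f') • o) ≤
      C + δ + 3 * E := by
  have hcore : gromovProduct o (b ^ q • o) ((a ^ (e' - e) * b ^ q) • o) ≤ C + δ := by
    rw [mul_smul]
    exact gromovProduct_smul_self_le hδ (zpow_neg a (e' - e) ▸ hC _ q) (hC _ q) hdiff
  have hbase := gromovProduct_le_add_base o (a ^ e • o) ((a ^ e * b ^ q * a ^ f) • o)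
    ((a ^ e' * b ^ q * a ^ f') • o)
  rw [gromovProduct_smul_base, ← mul_smul, ← mul_smul,
    show (a ^ e)⁻¹ * (a ^ e * b ^ q * a ^ f) = b ^ q * a ^ f by group,
    show (a ^ e)⁻¹ * (a ^ e' * b ^ q * a ^ f') = a ^ (e' - e) * b ^ q * a ^ f' by group] at hbase
  have hleft := gromovProduct_le_add_left o ((b ^ q * a ^ f) • o) (b ^ q • o)
    ((a ^ (e' - e) * b ^ q * a ^ f') • o)
  have hright := gromovProduct_le_add_right o (b ^ q • o) ((a ^ (e' - e) * b ^ q * a ^ f') • o)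
    ((a ^ (e' - e) * b ^ q) • o)
  rw [mul_smul (b ^ q), dist_smul, dist_comm] at hleft
  rw [mul_smul (a ^ (e' - e) * b ^ q), dist_smul, dist_comm] at hright
  simp only [mul_smul] at *
  linarith

/-- The members of the Schottky families built from two independent loxodromic elements. As words
in `a` and `b` they all have the same length in each letter. -/
def schottkyElement (a b : G) (N p q : ℕ) (i : Fin N) : G :=
  a ^ (i * p) * b ^ q * a ^ ((N - i) * p)

lemma schottkyElement_eq_zpow (a b : G) (N p q : ℕ) (i : Fin N) :
    schottkyElement a b N p q i =
      a ^ ((i * p : ℕ) : ℤ) * b ^ (q : ℤ) * a ^ (((N - i) * p : ℕ) : ℤ) := by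
  simp only [schottkyElement, zpow_natCast]

lemma schottkyElement_inv_eq_zpow (a b : G) (N p q : ℕ) (i : Fin N) :
    (schottkyElement a b N p q i)⁻¹ =
      a ^ (-((N - i) * p : ℕ) : ℤ) * b ^ (-q : ℤ) * a ^ (-(i * p : ℕ) : ℤ) := by
  simp only [schottkyElement, mul_inv_rev, zpow_neg, zpow_natCast, mul_assoc]

lemma subsingleton_lt_gromovProduct {ι : Type*} {δ C : ℝ} (hδ : FourPointCondition X δ) {o : X}
    {x : ι → X} (hx : Pairwise fun i j => gromovProduct o (x i) (x j) ≤ C) (y : X) :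
    {i | C + δ < gromovProduct o y (x i)}.Subsingleton := by
  intro i hi j hj
  by_contra hij
  rw [Set.mem_ofPred_eq] at hi hj
  have := hx hij
  linarith [hδ.gromovProduct_le_of_lt_right (w := o) (x := x i) (y := y) (z := x j) (by linarith),
    gromovProduct_comm o y (x i)]

lemma abs_dist_mul_mul_smul_sub_le (o : X) (u g v : G) :
    |dist o ((u * g * v) • o) - dist o (g • o)| ≤ dist o (u • o) + dist o (v • o) := by
  have h₁ := dist_mul_smul_le o (u * g) v
  have h₂ := dist_mul_smul_le o u g
  have h₃ := dist_mul_smul_le o (u⁻¹ * (u * g * v)) v⁻¹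
  have h₄ := dist_mul_smul_le o u⁻¹ (u * g * v)
  rw [show u⁻¹ * (u * g * v) * v⁻¹ = g by group, dist_inv_smul_self] at h₃
  rw [dist_inv_smul_self] at h₄
  rw [abs_le]
  constructor <;> linarith

lemma dist_zpow_smul_eq_natAbs (o : X) (a : G) (n : ℤ) :
    dist o (a ^ n • o) = dist o (a ^ n.natAbs • o) := by
  obtain ⟨n, rfl | rfl⟩ := n.eq_nat_or_neg
  · rw [zpow_natCast, Int.natAbs_natCast]
  · rw [zpow_neg, dist_inv_smul_self, zpow_natCast, Int.natAbs_neg, Int.natAbs_natCast]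

lemma pairwise_gromovProduct_schottkyElement_le {δ C E : ℝ} (hδ : FourPointCondition X δ) {o : X}
    {a b : G} {N p : ℕ} (hC : ∀ m n : ℤ, gromovProduct o (a ^ m • o) (b ^ n • o) ≤ C)
    (hfar : ∀ k : ℕ, p ≤ k → 2 * C + δ < dist o (a ^ k • o))
    (hE : ∀ k ≤ N * p, dist o (a ^ k • o) ≤ E) (q : ℕ) :
    (Pairwise fun i j => gromovProduct o (schottkyElement a b N p q i • o)
      (schottkyElement a b N p q j • o) ≤ C + δ + 3 * E) ∧
    Pairwise fun i j => gromovProduct o ((schottkyElement a b N p q i)⁻¹ • o)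
      ((schottkyElement a b N p q j)⁻¹ • o) ≤ C + δ + 3 * E := by
  have hE' : ∀ k ≤ N * p, dist o (a ^ (k : ℤ) • o) ≤ E := by simpa only [zpow_natCast] using hE
  have hE_neg : ∀ k ≤ N * p, dist o (a ^ (-k : ℤ) • o) ≤ E := by
    simpa only [zpow_neg, zpow_natCast, dist_inv_smul_self] using hE
  have hfar' : ∀ i j : Fin N, i ≠ j →
      2 * C + δ < dist o (a ^ (((j : ℤ) - i) * p) • o) := fun i j hij => by
    rw [dist_zpow_smul_eq_natAbs, Int.natAbs_mul, Int.natAbs_natCast]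
    exact hfar _ (Nat.le_mul_of_pos_left p (by omega))
  have hleft : ∀ i : Fin N, (i : ℕ) * p ≤ N * p := fun i => Nat.mul_le_mul_right _ i.2.le
  have hright : ∀ i : Fin N, (N - i) * p ≤ N * p := fun i => Nat.mul_le_mul_right _ (N.sub_le i)
  constructor <;> intro i j hij
  · rw [schottkyElement_eq_zpow, schottkyElement_eq_zpow]
    refine gromovProduct_zpow_conj_le hδ hC ?_ (hE' _ (hleft i)) (hE' _ (hright i))
      (hE' _ (hright j))
    convert hfar' i j hij using 4
    push_cast
    ring
  · rw [schottkyElement_inv_eq_zpow, schottkyElement_inv_eq_zpow]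
    refine gromovProduct_zpow_conj_le hδ hC ?_ (hE_neg _ (hright i)) (hE_neg _ (hleft i))
      (hE_neg _ (hleft j))
    convert hfar' i j hij using 4
    push_cast [i.2.le, j.2.le]
    ring

lemma isSchottky_schottkyElement {δ C D E : ℝ} (hδ : FourPointCondition X δ) {o : X} {a b : G}
    {N p q : ℕ} (hC : ∀ m n : ℤ, gromovProduct o (a ^ m • o) (b ^ n • o) ≤ C)
    (hfar : ∀ k : ℕ, p ≤ k → 2 * C + δ < dist o (a ^ k • o))
    (hE : ∀ k ≤ N * p, dist o (a ^ k • o) ≤ E) (hD : D = dist o (b ^ q • o) - 2 * E)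
    (hED : 4 * E ≤ D) :
    IsSchottky o (C + 2 * δ + 3 * E) D (schottkyElement a b N p q) := by
  obtain ⟨hpair, hpair_inv⟩ := pairwise_gromovProduct_schottkyElement_le hδ hC hfar hE q
  have hsize : ∀ i, |dist o (schottkyElement a b N p q i • o) - dist o (b ^ q • o)| ≤ 2 * E :=
    fun i => (abs_dist_mul_mul_smul_sub_le o _ _ _).trans <| by
      linarith [hE _ (Nat.mul_le_mul_right p i.2.le), hE _ (Nat.mul_le_mul_right p (N.sub_le i))]
  rw [show C + 2 * δ + 3 * E = C + δ + 3 * E + δ by ring]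
  exact ⟨subsingleton_lt_gromovProduct hδ hpair, subsingleton_lt_gromovProduct hδ hpair_inv,
    fun i => by linarith [(abs_le.1 (hsize i)).1], fun i => by linarith [(abs_le.1 (hsize i)).2]⟩

lemma FourPointCondition.le_dist_of_gromovProduct_le {δ C : ℝ} (hδ : FourPointCondition X δ)
    {o p y z : X} (hy : gromovProduct o y p ≤ C) (hz : gromovProduct p o z ≤ C)
    (hp : 2 * C + δ < dist o p) :
    dist y o + dist o p + dist p z - 4 * C - 2 * δ ≤ dist y z := by
  have hsum := gromovProduct_add_gromovProduct o p y
  rw [gromovProduct_comm] at hsum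
  have := hδ.gromovProduct_le_of_lt_left (w := p) (x := o) (y := y) (z := z) (by linarith)
  linarith [dist_eq_add_sub_gromovProduct o y p, dist_eq_add_sub_gromovProduct p y z,
    dist_comm y o, dist_comm y p]

section Average

variable {ι : Type*} {δ C D : ℝ} {o : X} {s : ι → G}

lemma IsSchottky.le_dist_smul (hδ : FourPointCondition X δ) (hs : IsSchottky o C D s)
    (hD : 2 * C + δ < D) {x y : X} {i : ι} (hy : gromovProduct o y (s i • o) ≤ C)
    (hx : gromovProduct o x ((s i)⁻¹ • o) ≤ C) :
    dist y o + (D + dist o x - 4 * C - 2 * δ) ≤ dist y (s i • x) := by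
  have hi := hs.le_dist i
  have := hδ.le_dist_of_gromovProduct_le (o := o) (p := s i • o) (y := y) (z := s i • x) hy
    (by rwa [gromovProduct_smul_base, inv_smul_smul, gromovProduct_comm]) (by linarith)
  rw [dist_smul] at this
  linarith

lemma IsSchottky.sub_le_dist_smul (hs : IsSchottky o C D s) (x y : X) (i : ι) :
    dist y o - (2 * D + dist o x) ≤ dist y (s i • x) := by
  have := dist_triangle4 y (s i • x) (s i • o) o
  rw [dist_smul, dist_comm x, dist_comm (s i • o)] at this
  linarith [hs.dist_le i]

variable [Fintype ι]

omit [IsIsometricSMul G X] in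
open Classical in
lemma IsSchottky.card_filter_le (hs : IsSchottky o C D s) (x y : X) :
    (Finset.univ.filter fun i => C < gromovProduct o y (s i • o) ∨
      C < gromovProduct o x ((s i)⁻¹ • o)).card ≤ 2 := by
  have card_le_one : ∀ P : ι → Prop, {i | P i}.Subsingleton → (Finset.univ.filter P).card ≤ 1 :=
    fun P hP => Finset.card_le_one.2 fun i hi j hj =>
      hP (Finset.mem_filter.1 hi).2 (Finset.mem_filter.1 hj).2
  rw [Finset.filter_or]
  exact (Finset.card_union_le _ _).trans
    (add_le_add (card_le_one _ (hs.subsingleton y)) (card_le_one _ (hs.subsingleton_inv x)))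

/-- At most two members of the family can bring `y` closer to the base point, and the gain `D` of
the others outweighs the loss. -/
lemma IsSchottky.card_mul_le_sum_dist (hδ : FourPointCondition X δ) (hs : IsSchottky o C D s)
    (hC : 0 ≤ C) (hD : 8 * C + 4 * δ + 2 ≤ D) (hcard : 12 ≤ Fintype.card ι) (y x : X) :
    Fintype.card ι * (dist y o + 1) ≤ ∑ i, dist y (s i • x) := by
  classical
  have := hδ.nonneg o
  set t := dist o x
  have ht0 : 0 ≤ t := dist_nonneg
  set bad := Finset.univ.filter fun i => C < gromovProduct o y (s i • o) ∨
    C < gromovProduct o x ((s i)⁻¹ • o) with hbad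
  have hpoint : ∀ i, dist y o + (D + t - 4 * C - 2 * δ) -
      (if i ∈ bad then 3 * D + 2 * t else 0) ≤ dist y (s i • x) := by
    intro i
    split_ifs with hi
    · linarith [hs.sub_le_dist_smul x y i]
    · simp only [hbad, Finset.mem_filter, Finset.mem_univ, true_and, not_or, not_lt] at hi
      linarith [hs.le_dist_smul hδ (by linarith) hi.1 hi.2]
  have hsum := Finset.sum_le_sum fun i (_ : i ∈ Finset.univ) => hpoint i
  rw [Finset.sum_sub_distrib, Finset.sum_const, Finset.card_univ, nsmul_eq_mul,
    Finset.sum_ite_mem, Finset.univ_inter, Finset.sum_const, nsmul_eq_mul] at hsum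
  have hbad_card : (bad.card : ℝ) ≤ 2 := by exact_mod_cast hs.card_filter_le x y
  have hloss : (bad.card : ℝ) * (3 * D + 2 * t) ≤ 2 * (3 * D + 2 * t) :=
    mul_le_mul_of_nonneg_right hbad_card (by linarith)
  have hcard' : (12 : ℝ) ≤ Fintype.card ι := by exact_mod_cast hcard
  have hgain : 12 * (D + t - 4 * C - 2 * δ - 1) ≤
      Fintype.card ι * (D + t - 4 * C - 2 * δ - 1) := by
    gcongr
    linarith
  linarith

end Average

end Schottky

section Independent

variable {G : Type*} [Group G] {X : Type*} [MetricSpace X] [MulAction G X] [IsIsometricSMul G X]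

lemma AreIndependentLoxodromic.exists_isSchottky {δ : ℝ} (hδ : FourPointCondition X δ) (o : X)
    {a b : G} (h : AreIndependentLoxodromic X a b) (N : ℕ) :
    ∃ (p : ℕ) (C : ℝ), 0 ≤ C ∧ ∀ D₀ : ℝ, ∃ (q : ℕ) (D : ℝ), D₀ ≤ D ∧
      IsSchottky o C D (schottkyElement a b N p q) := by
  have := hδ.nonneg o
  obtain ⟨C, hC⟩ := h.exists_gromovProduct_zpow_zpow_le hδ o
  have hC0 : 0 ≤ C := (gromovProduct_nonneg _ _ _).trans (hC 0 0)
  obtain ⟨τ, hτ, ha⟩ := h.1.exists_linear_growth o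
  obtain ⟨σ, hσ, hb⟩ := h.2.1.exists_linear_growth o
  obtain ⟨p, hp⟩ := exists_nat_gt ((2 * C + δ) / τ)
  rw [div_lt_iff₀' hτ] at hp
  have hfar : ∀ k : ℕ, p ≤ k → 2 * C + δ < dist o (a ^ k • o) := fun k hk =>
    hp.trans_le (le_trans (by gcongr) (ha k))
  set E := (N * p : ℕ) * dist o (a • o)
  have hE0 : 0 ≤ E := by positivity
  have hE : ∀ k ≤ N * p, dist o (a ^ k • o) ≤ E := fun k hk =>
    (dist_pow_smul_le o a k).trans
      (mul_le_mul_of_nonneg_right (by exact_mod_cast hk) dist_nonneg)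
  refine ⟨p, C + 2 * δ + 3 * E, by positivity, fun D₀ => ?_⟩
  obtain ⟨q, hq⟩ := exists_nat_gt ((|D₀| + 6 * E) / σ)
  rw [div_lt_iff₀' hσ] at hq
  have := hb q
  exact ⟨q, _, by linarith [le_abs_self D₀],
    isSchottky_schottkyElement hδ hC hfar hE rfl (by linarith [abs_nonneg D₀])⟩

end Independent

section Criterion

section Pseudo

variable {G : Type*} [Group G] {X : Type*} [PseudoMetricSpace X] [MulAction G X]
  [IsIsometricSMul G X]

lemma FourPointCondition.dist_le_abs_sub_add {X : Type*} [PseudoMetricSpace X] {δ A : ℝ}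
    (hδ : FourPointCondition X δ) {o y p q : X} (hp : gromovProduct p o y ≤ A)
    (hq : gromovProduct q o y ≤ A) : dist p q ≤ |dist o p - dist o q| + 2 * A + 2 * δ := by
  have hmin := hδ o p y q
  have hsum_p := gromovProduct_add_gromovProduct o p y
  have hsum_q := gromovProduct_add_gromovProduct o q y
  have hdist := dist_eq_add_sub_gromovProduct o p q
  have habs := abs_le.1 (le_refl |dist o p - dist o q|)
  rw [gromovProduct_comm o y q] at hmin
  rcases min_le_iff.1 hmin with h | h <;> linarith [habs.1, habs.2]

lemma abs_dist_smul_sub_le {o : X} {f : G} {K : ℝ} (hf : dist o (f • o) ≤ K) (p : X) :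
    |dist o (f • p) - dist o p| ≤ K := by
  have := abs_dist_sub_le o (f • o) (f • p)
  rw [dist_smul] at this
  exact this.trans hf

lemma FourPointCondition.gromovProduct_smul_le {δ A K : ℝ} (hδ : FourPointCondition X δ)
    {o y p : X} {f : G} (ho : dist o (f • o) ≤ K) (hy : dist y (f • y) ≤ K)
    (hp : gromovProduct p o y ≤ A) (hpo : K + A + 2 * δ < dist p o)
    (hpy : K + A + 2 * δ < dist p y) : gromovProduct (f • p) o y ≤ A + 2 * δ := by
  rw [gromovProduct_smul_base]
  have hmin := hδ.min_le p o (f⁻¹ • o) (f⁻¹ • y) y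
  have hgp_o := dist_sub_dist_le_gromovProduct p o (f⁻¹ • o)
  have hgp_y := dist_sub_dist_le_gromovProduct p y (f⁻¹ • y)
  rw [dist_inv_smul_self] at hgp_o hgp_y
  rw [gromovProduct_comm p (f⁻¹ • y) y] at hmin
  simp only [min_le_iff] at hmin
  rcases hmin with h | h | h <;> linarith

end Pseudo

variable {G : Type*} [Group G] {X : Type*} [MetricSpace X] [MulAction G X] [IsIsometricSMul G X]

lemma finite_jointCoarseStab_smul {K : ℝ} {x y : X} (h : (jointCoarseStab G K x y).Finite)
    (g : G) : (jointCoarseStab G K (g • x) (g • y)).Finite := by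
  refine (h.image fun f => g * f * g⁻¹).subset fun f hf => ⟨g⁻¹ * f * g, ?_, by group⟩
  have hconj : ∀ z : X, dist z ((g⁻¹ * f * g) • z) = dist (g • z) (f • g • z) := fun z => by
    rw [mul_smul, mul_smul, ← dist_smul g z, smul_inv_smul]
  exact ⟨(hconj x).trans_le hf.1, (hconj y).trans_le hf.2⟩

lemma jointCoarseStab_subset {K : ℝ} (x o : X) (h : G) :
    jointCoarseStab G K x (h • x) ⊆ jointCoarseStab G (K + 2 * dist x o) o (h • o) := by
  intro f hf
  have move : ∀ g : G, dist (g • x) (f • g • x) ≤ K →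
      dist (g • o) (f • g • o) ≤ K + 2 * dist x o := by
    intro g hg
    have := dist_triangle4 (g • o) (g • x) (f • g • x) (f • g • o)
    rw [dist_smul, dist_smul, dist_smul, dist_comm o x] at this
    linarith
  exact ⟨by simpa only [one_smul] using move 1 (by simpa only [one_smul] using hf.1), move _ hf.2⟩

lemma FourPointCondition.dist_inv_mul_smul_le {δ A K : ℝ} (hδ : FourPointCondition X δ)
    {o y z : X} {f₁ f₂ : G} (hf₁ : f₁ ∈ jointCoarseStab G K o y)
    (hf₂ : f₂ ∈ jointCoarseStab G K o y) (hfloor : ⌊dist o (f₁ • z)⌋ = ⌊dist o (f₂ • z)⌋)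
    (hz : gromovProduct z o y ≤ A) (hzo : K + A + 2 * δ < dist z o)
    (hzy : K + A + 2 * δ < dist z y) :
    dist z ((f₁⁻¹ * f₂) • z) ≤ 2 * A + 6 * δ + 1 := by
  rw [← dist_smul f₁, ← mul_smul, mul_inv_cancel_left]
  have := hδ.dist_le_abs_sub_add (hδ.gromovProduct_smul_le hf₁.1 hf₁.2 hz hzo hzy)
    (hδ.gromovProduct_smul_le hf₂.1 hf₂.2 hz hzo hzy)
  linarith [Int.abs_sub_lt_one_of_floor_eq_floor hfloor]

/-- Up to finitely many choices of the positions of the images of `p` and `q` along the long segment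
from `o` to `y`, its coarse stabilizer is a coset of that of `p` and `q`. -/
lemma FourPointCondition.finite_jointCoarseStab {δ A K : ℝ} (hδ : FourPointCondition X δ)
    {o y p q : X} (hfin : (jointCoarseStab G (2 * A + 6 * δ + 1) p q).Finite)
    (hp : gromovProduct p o y ≤ A) (hq : gromovProduct q o y ≤ A)
    (hpo : K + A + 2 * δ < dist p o) (hpy : K + A + 2 * δ < dist p y)
    (hqo : K + A + 2 * δ < dist q o) (hqy : K + A + 2 * δ < dist q y) :
    (jointCoarseStab G K o y).Finite := by
  let φ : G → ℤ × ℤ := fun f => (⌊dist o (f • p)⌋, ⌊dist o (f • q)⌋)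
  have himage : (φ '' jointCoarseStab G K o y).Finite := by
    refine ((Set.finite_Icc ⌊dist o p - K⌋ ⌊dist o p + K⌋).prod
      (Set.finite_Icc ⌊dist o q - K⌋ ⌊dist o q + K⌋)).subset ?_
    rintro _ ⟨f, hf, rfl⟩
    have hfp := abs_le.1 (abs_dist_smul_sub_le hf.1 p)
    have hfq := abs_le.1 (abs_dist_smul_sub_le hf.1 q)
    exact ⟨⟨Int.floor_mono (by linarith), Int.floor_mono (by linarith)⟩,
      ⟨Int.floor_mono (by linarith), Int.floor_mono (by linarith)⟩⟩
  refine Set.Finite.of_finite_fibers φ himage ?_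
  rintro _ ⟨f₁, hf₁, rfl⟩
  refine (hfin.image fun f => f₁ * f).subset ?_
  rintro f ⟨hf, hφ : φ f = φ f₁⟩
  refine ⟨f₁⁻¹ * f, ⟨?_, ?_⟩, mul_inv_cancel_left f₁ f⟩
  · exact hδ.dist_inv_mul_smul_le hf₁ hf (congrArg Prod.fst hφ).symm hp hpo hpy
  · exact hδ.dist_inv_mul_smul_le hf₁ hf (congrArg Prod.snd hφ).symm hq hqo hqy

lemma IsWPD.exists_pow {δ : ℝ} (hδ : FourPointCondition X δ) {h : G} (hh : IsWPD X h) (o : X)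
    {K : ℝ} (hK : 0 ≤ K) (B : ℝ) :
    ∃ M : ℕ, (jointCoarseStab G K o (h ^ M • o)).Finite ∧ B ≤ dist o (h ^ M • o) := by
  have := hδ.nonneg o
  obtain ⟨C, hC0, hC⟩ := hh.1.exists_gromovProduct_pow_le hδ o
  obtain ⟨τ, hτ, hgrowth⟩ := hh.1.exists_linear_growth o
  obtain ⟨M, -, hM⟩ := hh.2 (5 * K + 2 * C + 2 * δ) (by positivity) o
  obtain ⟨n, hn⟩ := exists_nat_ge (B / τ)
  rw [div_le_iff₀' hτ] at hn
  refine ⟨M + n, hM.subset fun f hf => ⟨by linarith [hf.1], ?_⟩, ?_⟩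
  · set p := h ^ M • o
    set y := h ^ (M + n) • o
    have hp : gromovProduct p o y ≤ C := hC M (M + n) (by omega)
    have hfp : gromovProduct (f • p) o y ≤ C + 2 * K := by
      rw [gromovProduct_smul_base]
      have hleft := gromovProduct_le_add_left p (f⁻¹ • o) o (f⁻¹ • y)
      have hright := gromovProduct_le_add_right p o (f⁻¹ • y) y
      rw [dist_comm, dist_inv_smul_self] at hleft hright
      linarith [hf.1, hf.2]
    have hdist := hδ.dist_le_abs_sub_add (hp.trans (by linarith : C ≤ C + 2 * K)) hfp
    have habs := abs_dist_smul_sub_le hf.1 p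
    rw [abs_sub_comm] at habs
    linarith
  · refine le_trans ?_ (hgrowth _)
    push_cast
    nlinarith [mul_nonneg hτ.le (Nat.cast_nonneg (α := ℝ) M)]

lemma IsChain.finite_jointCoarseStab {δ : ℝ} (hδ : FourPointCondition X δ) {x : ℕ → X}
    {c : ℕ → ℝ} (h : IsChain δ x c) {j n : ℕ} {C K : ℝ} (hK : 0 ≤ K) (hj : c j ≤ C)
    (hj' : c (j + 1) ≤ C)
    (hfin : (jointCoarseStab G (2 * C + 10 * δ + 1) (x j) (x (j + 1))).Finite)
    (hstart : K + C + 4 * δ + c 0 < j) (hend : K + 2 * C + 4 * δ < n - (j + 1)) :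
    (jointCoarseStab G K (x 0) (x n)).Finite := by
  have := hδ.nonneg (x 0)
  have hc₀ := h.nonneg 0
  have hcj := h.nonneg j
  have hcj' := h.nonneg (j + 1)
  have hcn := h.nonneg n
  have hj0 : 0 < j := by exact_mod_cast (by linarith : (0 : ℝ) < j)
  have hjn : j + 1 < n := by exact_mod_cast (by push_cast; linarith : ((j + 1 : ℕ) : ℝ) < n)
  have hle : ∀ i k, i ≤ k → c k - c i + (k - i : ℝ) ≤ dist (x i) (x k) := fun i k hik => by
    simpa only [Nat.add_sub_cancel' hik, Nat.cast_sub hik] using h.le_dist_add hδ i (k - i)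
  have h₀ := hle 0 j hj0.le
  have h₀' := hle 0 (j + 1) (by omega)
  have hn := hle j n (by omega)
  have hn' := hle (j + 1) n hjn.le
  push_cast at h₀ h₀' hn hn'
  rw [dist_comm] at h₀ h₀'
  rw [show 2 * C + 10 * δ + 1 = 2 * (C + 2 * δ) + 6 * δ + 1 by ring] at hfin
  refine hδ.finite_jointCoarseStab hfin ?_ ?_ ?_ ?_ ?_ ?_
  · exact (h.gromovProduct_le_of_lt hδ hj0 (by omega)).trans (by gcongr)
  · exact (h.gromovProduct_le_of_lt hδ (by omega) hjn).trans (by gcongr)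
  all_goals linarith

lemma walk_mul_of_periodic {G : Type*} [Group G] {T : ℕ → G} {P : ℕ}
    (hT : Function.Periodic T P) (q : ℕ) : walk T (q * P) = walk T P ^ q := by
  have walk_add_period : ∀ i, walk T (i + P) = walk T P * walk T i := by
    intro i
    induction i with
    | zero => simp [walk]
    | succ i ih => rw [Nat.add_right_comm, walk, ih, hT, walk, mul_assoc]
  induction q with
  | zero => simp [walk]
  | succ q ih => rw [Nat.succ_mul, walk_add_period, ih, pow_succ']

lemma isWPD_walk_of_isChain {δ : ℝ} (hδ : FourPointCondition X δ) {o : X} {T : ℕ → G}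
    {c : ℕ → ℝ} {P : ℕ} (hP : 0 < P) (hT : Function.Periodic T P) (hc : Function.Periodic c P)
    (hchain : IsChain δ (fun i => walk T i • o) c) {r : ℕ} {C : ℝ} (hr : c r ≤ C)
    (hr' : c (r + 1) ≤ C)
    (hfin : (jointCoarseStab G (2 * C + 10 * δ + 1) o (T r • o)).Finite) :
    IsWPD X (walk T P) := by
  have le_mul : ∀ j : ℕ, (j : ℝ) ≤ (j * P : ℕ) := fun j => by
    exact_mod_cast Nat.le_mul_of_pos_right j hP
  refine ⟨isLoxodromic_of_linear_growth (o := o) (κ := 1) (C := 0) one_pos fun n => ?_, ?_⟩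
  · have hlow := hchain.le_dist_add hδ 0 (n * P)
    have hcn : c (0 + n * P) = c 0 := by simpa using hc.nsmul n 0
    rw [hcn, zero_add, walk_mul_of_periodic hT, walk, one_smul] at hlow
    linarith [le_mul n]
  intro K hK x
  set K' := K + 2 * dist x o
  have hK' : 0 ≤ K' := by positivity
  obtain ⟨j, hj⟩ := exists_nat_gt (K' + 2 * C + 4 * δ + c 0 + r + 1)
  have hj₀ := hchain.nonneg 0
  have hjr := (hchain.nonneg r).trans hr
  have := hδ.nonneg x
  have hjP := le_mul j
  have hj_pos : 0 < j := by exact_mod_cast (by linarith [r.cast_nonneg (α := ℝ)] : (0 : ℝ) < j)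
  have hTj : T (r + j * P) = T r := hT.nsmul j r
  have hcj : c (r + j * P) = c r := hc.nsmul j r
  have hcj' : c (r + j * P + 1) = c (r + 1) := by
    rw [Nat.add_right_comm]
    exact hc.nsmul j (r + 1)
  have hlink := finite_jointCoarseStab_smul hfin (walk T (r + j * P))
  rw [← hTj, ← mul_smul] at hlink
  refine ⟨2 * j, by omega, (?_ : Set.Finite _).subset (jointCoarseStab_subset x o _)⟩
  have hfinite := hchain.finite_jointCoarseStab hδ hK' (hcj.trans_le hr) (hcj'.trans_le hr') hlink
    (n := 2 * j * P) (by push_cast at hjP ⊢; linarith) (by push_cast at hjP ⊢; linarith)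
  simpa only [walk_mul_of_periodic hT, show walk T 0 • o = o from one_smul G o] using hfinite

lemma walk_eq_prod_map_range {G : Type*} [Group G] (T : ℕ → G) (n : ℕ) :
    walk T n = ((List.range n).map T).prod := by
  induction n with
  | zero => rfl
  | succ n ih =>
    rw [walk, ih, List.range_succ, List.map_append, List.prod_append, List.map_singleton,
      List.prod_singleton]

/-- The word `t` is cyclic: `i + 1` wraps around. -/
lemma isWPD_prod_ofFn {δ : ℝ} (hδ : FourPointCondition X δ) {o : X} {n : ℕ} [NeZero n]
    {t : Fin n → G} {c : Fin n → ℝ} (hc : ∀ i, 0 ≤ c i)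
    (hgp : ∀ i, gromovProduct o ((t i)⁻¹ • o) (t (i + 1) • o) ≤ c (i + 1))
    (hdist : ∀ i, c i + c (i + 1) + 3 * δ + 1 ≤ dist o (t i • o)) {r : Fin n} {C : ℝ}
    (hr : c r ≤ C) (hr' : c (r + 1) ≤ C)
    (hfin : (jointCoarseStab G (2 * C + 10 * δ + 1) o (t r • o)).Finite) :
    IsWPD X (List.ofFn t).prod := by
  have ofNat_succ : ∀ i : ℕ, Fin.ofNat n (i + 1) = Fin.ofNat n i + 1 := fun i => by
    ext; simp [Fin.val_add]
  have ofNat_periodic : Function.Periodic (Fin.ofNat n) n := fun i => by ext; simp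
  have ofNat_val : ∀ i : Fin n, Fin.ofNat n i = i := fun i => by ext; simp
  have hwalk : walk (t ∘ Fin.ofNat n) n = (List.ofFn t).prod := by
    rw [walk_eq_prod_map_range]
    congr 1
    exact List.ext_getElem (by simp) fun i hi _ => by
      simpa using congrArg t (ofNat_val ⟨i, by simpa using hi⟩)
  rw [← hwalk]
  refine isWPD_walk_of_isChain hδ (o := o) (c := c ∘ Fin.ofNat n) (r := r) (NeZero.pos n)
    (ofNat_periodic.comp t) (ofNat_periodic.comp c)
    (isChain_walk_smul (fun i => hc _) (fun i => ?_) (fun i => ?_)) (C := C) ?_ ?_ ?_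
  all_goals simp only [Function.comp_apply, ofNat_succ, ofNat_val]
  exacts [hgp _, hdist _, hr, hr', hfin]

lemma isWPD_of_aligned {δ : ℝ} (hδ : FourPointCondition X δ) {o : X} {u s h s' v z : G} {C r : ℝ}
    (hC : 0 ≤ C) (hr : 0 ≤ r)
    (h₀ : gromovProduct o (z⁻¹ • o) (u • o) ≤ r) (h₁ : gromovProduct o (u⁻¹ • o) (s • o) ≤ C)
    (h₂ : gromovProduct o (s⁻¹ • o) (h • o) ≤ C) (h₃ : gromovProduct o (h⁻¹ • o) (s' • o) ≤ C)
    (h₄ : gromovProduct o (s'⁻¹ • o) (v • o) ≤ C) (h₅ : gromovProduct o (v⁻¹ • o) (z • o) ≤ r)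
    (hu : r + C + 3 * δ + 1 ≤ dist o (u • o)) (hs : 2 * C + 3 * δ + 1 ≤ dist o (s • o))
    (hh : 2 * C + 3 * δ + 1 ≤ dist o (h • o)) (hs' : 2 * C + 3 * δ + 1 ≤ dist o (s' • o))
    (hv : r + C + 3 * δ + 1 ≤ dist o (v • o)) (hz : 2 * r + 3 * δ + 1 ≤ dist o (z • o))
    (hfin : (jointCoarseStab G (2 * C + 10 * δ + 1) o (h • o)).Finite) :
    IsWPD X (u * s * h * s' * v * z) := by
  have hprod : (List.ofFn ![u, s, h, s', v, z]).prod = u * s * h * s' * v * z := by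
    simp [mul_assoc]
  rw [← hprod]
  refine isWPD_prod_ofFn hδ (c := ![r, C, C, C, C, r]) (r := 2) (fun i => ?_) (fun i => ?_)
    (fun i => ?_) le_rfl le_rfl hfin
  · fin_cases i <;> assumption
  · fin_cases i <;> assumption
  · fin_cases i <;> simp <;> linarith

end Criterion

section PMF

variable {α β : Type*} [MeasurableSpace α] [DiscreteMeasurableSpace α] [MeasurableSpace β]
  [DiscreteMeasurableSpace β]

lemma ae_mem_support (q : PMF α) : ∀ᵐ a ∂q.toMeasure, a ∈ q.support := by
  change q.toMeasure q.supportᶜ = 0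
  exact (q.toMeasure_apply_eq_zero_iff .of_discrete).2 disjoint_compl_right

lemma lintegral_toMeasure (q : PMF α) (F : α → ℝ≥0∞) :
    ∫⁻ a, F a ∂q.toMeasure = ∑' a, q a * F a := by
  have hsum : q.toMeasure = Measure.sum fun a => q a • Measure.dirac a := by
    ext s hs
    rw [q.toMeasure_apply hs, Measure.sum_apply _ hs]
    refine tsum_congr fun a => ?_
    by_cases ha : a ∈ s <;> simp [ha, hs]
  rw [hsum, lintegral_sum_measure]
  exact tsum_congr fun a => by rw [lintegral_smul_measure, lintegral_dirac, smul_eq_mul]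

lemma lintegral_pure (a : α) (F : α → ℝ≥0∞) : ∫⁻ x, F x ∂(PMF.pure a).toMeasure = F a := by
  rw [PMF.toMeasure_pure, lintegral_dirac]

lemma lintegral_map_toMeasure (q : PMF α) (f : α → β) (F : β → ℝ≥0∞) :
    ∫⁻ b, F b ∂(q.map f).toMeasure = ∫⁻ a, F (f a) ∂q.toMeasure := by
  rw [← PMF.toMeasure_map f q Measurable.of_discrete,
    lintegral_map Measurable.of_discrete Measurable.of_discrete]

lemma lintegral_bind_toMeasure {ι : Type*} (q : PMF ι) (f : ι → PMF α) (F : α → ℝ≥0∞) :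
    ∫⁻ a, F a ∂(q.bind f).toMeasure = ∑' i, q i * ∫⁻ a, F a ∂(f i).toMeasure := by
  simp only [lintegral_toMeasure, PMF.bind_apply, ← ENNReal.tsum_mul_right,
    ← ENNReal.tsum_mul_left, mul_assoc]
  exact ENNReal.tsum_comm

lemma lintegral_lintegral_toMeasure_comm (q : PMF α) (q' : PMF β) (F : α → β → ℝ≥0∞) :
    ∫⁻ a, ∫⁻ b, F a b ∂q'.toMeasure ∂q.toMeasure =
      ∫⁻ b, ∫⁻ a, F a b ∂q.toMeasure ∂q'.toMeasure := by
  simp only [lintegral_toMeasure, ← ENNReal.tsum_mul_left]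
  rw [ENNReal.tsum_comm]
  exact tsum_congr fun b => tsum_congr fun a => mul_left_comm _ _ _

lemma ae_of_mem_support {q : PMF α} {P : α → Prop} (h : ∀ a ∈ q.support, P a) :
    ∀ᵐ a ∂q.toMeasure, P a :=
  (ae_mem_support q).mono h

end PMF

-- Lists carry no measurable structure in Mathlib; here every event is measurable.
local instance {G : Type*} : MeasurableSpace (List G) := ⊤

local instance {G : Type*} : DiscreteMeasurableSpace (List G) := ⟨fun _ => trivial⟩

section Steps

variable {G : Type*}

/-- The law of a list of `n` independent elements with law `p`. -/
def steps (p : PMF G) : ℕ → PMF (List G)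
  | 0 => PMF.pure []
  | n + 1 => p.bind fun g => (steps p n).map (g :: ·)

lemma mem_support_steps {p : PMF G} {n : ℕ} {l : List G} :
    l ∈ (steps p n).support ↔ l.length = n ∧ ∀ g ∈ l, g ∈ p.support := by
  induction n generalizing l with
  | zero => cases l <;> simp [steps]
  | succ n ih =>
    simp only [steps, PMF.mem_support_bind_iff, PMF.mem_support_map_iff, ih]
    cases l with
    | nil => simp
    | cons g l => simp; tauto

lemma steps_length_apply (p : PMF G) (l : List G) : steps p l.length l = (l.map p).prod := by
  classical
  induction l with
  | nil => simp [steps]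
  | cons g l ih =>
    rw [List.length_cons, steps, PMF.bind_apply, tsum_eq_single g fun a ha => by
      simp [PMF.map_apply, ha.symm]]
    simp [PMF.map_apply, ih]

/-- The law of a list of `n` independent elements with law `p`, as a measure. -/
def listLaw (p : PMF G) (n : ℕ) : Measure (List G) := (steps p n).toMeasure

instance (p : PMF G) (n : ℕ) : IsProbabilityMeasure (listLaw p n) :=
  inferInstanceAs (IsProbabilityMeasure (steps p n).toMeasure)

variable {p : PMF G}

lemma ae_listLaw (p : PMF G) (n : ℕ) :
    ∀ᵐ l ∂listLaw p n, l.length = n ∧ ∀ g ∈ l, g ∈ p.support :=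
  ae_of_mem_support fun _ => mem_support_steps.1

lemma lintegral_listLaw_zero (F : List G → ℝ≥0∞) : ∫⁻ l, F l ∂listLaw p 0 = F [] :=
  lintegral_pure [] F

lemma lintegral_listLaw_succ (n : ℕ) (F : List G → ℝ≥0∞) :
    ∫⁻ l, F l ∂listLaw p (n + 1) = ∑' g, p g * ∫⁻ l, F (g :: l) ∂listLaw p n := by
  simp only [listLaw, steps, lintegral_bind_toMeasure, lintegral_map_toMeasure]

lemma lintegral_listLaw_add (m n : ℕ) (F : List G → ℝ≥0∞) :
    ∫⁻ l, F l ∂listLaw p (m + n) = ∫⁻ l, ∫⁻ l', F (l ++ l') ∂listLaw p n ∂listLaw p m := by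
  induction m generalizing F with
  | zero => simp only [Nat.zero_add, lintegral_listLaw_zero, List.nil_append]
  | succ m ih => simp only [Nat.succ_add, lintegral_listLaw_succ, ih, List.cons_append]

lemma listLaw_add_apply (m n : ℕ) (A : Set (List G)) :
    listLaw p (m + n) A = ∫⁻ l, listLaw p n {l' | l ++ l' ∈ A} ∂listLaw p m := by
  rw [← lintegral_indicator_one .of_discrete, lintegral_listLaw_add]
  exact lintegral_congr fun l => lintegral_indicator_one .of_discrete

lemma listLaw_add_take_drop (m n : ℕ) (Q : List G → List G → Prop) :
    listLaw p (m + n) {l | Q (l.take m) (l.drop m)} =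
      ∫⁻ l, listLaw p n {l' | Q l l'} ∂listLaw p m := by
  rw [listLaw_add_apply]
  refine lintegral_congr_ae ((ae_listLaw p m).mono fun l hl => ?_)
  have htake : ∀ l', (l ++ l').take m = l := fun l' => hl.1 ▸ List.take_left
  have hdrop : ∀ l', (l ++ l').drop m = l' := fun l' => hl.1 ▸ List.drop_left
  simp only [Set.mem_ofPred_eq, htake, hdrop]

lemma listLaw_take_drop_le_of_right {m n k : ℕ} (hk : k = m + n) {Q : List G → List G → Prop}
    {c : ℝ≥0∞} (h : ∀ l, l.length = m → listLaw p n {l' | Q l l'} ≤ c) :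
    listLaw p k {l | Q (l.take m) (l.drop m)} ≤ c := by
  rw [hk, listLaw_add_take_drop]
  exact lintegral_le_const ((ae_listLaw p m).mono fun l hl => h l hl.1)

lemma listLaw_take_drop_le_of_left {m n k : ℕ} (hk : k = m + n) {Q : List G → List G → Prop}
    {c : ℝ≥0∞} (h : ∀ l', listLaw p m {l | Q l l'} ≤ c) :
    listLaw p k {l | Q (l.take m) (l.drop m)} ≤ c := by
  rw [hk, listLaw_add_take_drop]
  calc ∫⁻ l, listLaw p n {l' | Q l l'} ∂listLaw p m
      = ∫⁻ l', ∫⁻ l, {l | Q l l'}.indicator 1 l ∂listLaw p m ∂listLaw p n := by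
        rw [listLaw, listLaw, ← lintegral_lintegral_toMeasure_comm]
        exact lintegral_congr fun l => (lintegral_indicator_one .of_discrete).symm
    _ ≤ c := lintegral_le_const <| .of_forall fun l' =>
        (lintegral_indicator_one (MeasurableSet.of_discrete)).trans_le (h l')

lemma listLaw_take {j n : ℕ} (hj : j ≤ n) (B : Set (List G)) :
    listLaw p n {l | l.take j ∈ B} = listLaw p j B := by
  obtain ⟨m, rfl⟩ := Nat.exists_eq_add_of_le hj
  rw [listLaw_add_take_drop j m fun l _ => l ∈ B, ← lintegral_indicator_one .of_discrete]
  refine lintegral_congr fun l => ?_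
  by_cases hl : l ∈ B <;> simp [hl]

end Steps

section ProdLaw

variable {G : Type*} [Group G] {p : PMF G}

/-- The law of the product of `n` independent elements with law `p`. -/
def prodLaw (p : PMF G) (n : ℕ) : PMF G := (steps p n).map List.prod

lemma mem_support_prodLaw {n : ℕ} {g : G} : g ∈ (prodLaw p n).support ↔
    ∃ l : List G, (l.length = n ∧ ∀ a ∈ l, a ∈ p.support) ∧ l.prod = g := by
  simp only [prodLaw, PMF.mem_support_map_iff, mem_support_steps]

lemma mul_mem_support_prodLaw {m n : ℕ} {g h : G} (hg : g ∈ (prodLaw p m).support)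
    (hh : h ∈ (prodLaw p n).support) : g * h ∈ (prodLaw p (m + n)).support := by
  obtain ⟨l, ⟨hl, hlp⟩, rfl⟩ := mem_support_prodLaw.1 hg
  obtain ⟨l', ⟨hl', hlp'⟩, rfl⟩ := mem_support_prodLaw.1 hh
  refine mem_support_prodLaw.2 ⟨l ++ l', ⟨by simp [hl, hl'], fun a ha => ?_⟩, List.prod_append⟩
  exact (List.mem_append.1 ha).elim (hlp a) (hlp' a)

lemma pow_mem_support_prodLaw {n : ℕ} {g : G} (hg : g ∈ (prodLaw p n).support) (k : ℕ) :
    g ^ k ∈ (prodLaw p (n * k)).support := by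
  induction k with
  | zero => exact mem_support_prodLaw.2 ⟨[], by simp, by simp⟩
  | succ k ih => exact pow_succ g k ▸ mul_mem_support_prodLaw ih hg

lemma exists_mem_support_prodLaw {g : G} (hg : g ∈ Subsemigroup.closure p.support) :
    ∃ n, g ∈ (prodLaw p n).support := by
  induction hg using Subsemigroup.closure_induction with
  | mem g hg => exact ⟨1, mem_support_prodLaw.2 ⟨[g], by simpa using hg, by simp⟩⟩
  | mul g h _ _ ihg ihh =>
    obtain ⟨m, hm⟩ := ihg
    obtain ⟨n, hn⟩ := ihh
    exact ⟨m + n, mul_mem_support_prodLaw hm hn⟩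

lemma prodLaw_apply (n : ℕ) (g : G) : prodLaw p n g = listLaw p n {l | l.prod = g} := by
  rw [prodLaw, ← PMF.toOuterMeasure_apply_singleton, PMF.toOuterMeasure_map_apply, listLaw,
    PMF.toMeasure_apply_eq_toOuterMeasure]
  rfl

lemma tsum_prodLaw_mul (n : ℕ) (f : G → ℝ≥0∞) :
    ∑' g, prodLaw p n g * f g = ∫⁻ l, f l.prod ∂listLaw p n := by
  let _ : MeasurableSpace G := ⊤
  rw [← lintegral_toMeasure, prodLaw, lintegral_map_toMeasure, listLaw]

lemma dist_list_prod_smul_le {X : Type*} [PseudoMetricSpace X] [MulAction G X]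
    [IsIsometricSMul G X] {o : X} {R : ℝ} {l : List G} (hl : ∀ g ∈ l, dist o (g • o) ≤ R) :
    dist o (l.prod • o) ≤ l.length * R := by
  induction l with
  | nil => simp
  | cons g l ih =>
    have hmul := dist_mul_smul_le o g l.prod
    have hhead := hl g (by simp)
    have htail := ih fun a ha => hl a (by simp [ha])
    rw [List.prod_cons, List.length_cons]
    push_cast
    linarith

end ProdLaw

section Splitting

variable {G ι : Type*} [Fintype ι]

/-- A Doeblin splitting of `q` along the family `s`: with probability `card ι * β` a `q`-step is
uniform on the family, and the remaining mass is distributed according to `r`. -/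
structure IsSplitting (q : PMF G) (s : ι → G) (β : ℝ≥0∞) (r : G → ℝ≥0∞) : Prop where
  ne_zero : β ≠ 0
  card_mul_add_tsum : Fintype.card ι * β + ∑' g, r g = 1
  mem_support : ∀ g, r g ≠ 0 → g ∈ q.support
  tsum_mul : ∀ f : G → ℝ≥0∞, ∑' g, q g * f g = β * ∑ i, f (s i) + ∑' g, r g * f g

lemma exists_isSplitting [Nonempty ι] (q : PMF G) {s : ι → G} (hs : ∀ i, s i ∈ q.support) :
    ∃ β r, IsSplitting q s β r := by
  classical
  obtain ⟨i₀, hi₀⟩ := Finite.exists_min fun i => q (s i)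
  set β := q (s i₀) / Fintype.card ι
  let c : G → ℝ≥0∞ := fun g => ∑ i, if s i = g then β else 0
  have hc : ∀ g, c g ≤ q g := by
    intro g
    by_cases hg : ∃ i, s i = g
    · obtain ⟨j, rfl⟩ := hg
      calc c (s j) ≤ ∑ _i : ι, β := Finset.sum_le_sum fun i _ => by split_ifs <;> simp
        _ = Fintype.card ι * β := by simp
        _ = q (s i₀) := ENNReal.mul_div_cancel (by simp) (by simp)
        _ ≤ q (s j) := hi₀ j
    · push Not at hg
      simp [c, hg]
  have hsum : ∀ f : G → ℝ≥0∞, β * ∑ i, f (s i) = ∑' g, c g * f g := by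
    intro f
    simp only [c, Finset.sum_mul, ite_mul, zero_mul]
    rw [Summable.tsum_finsetSum fun _ _ => ENNReal.summable, Finset.mul_sum]
    exact Finset.sum_congr rfl fun i _ => by simp
  have hsplit : ∀ f : G → ℝ≥0∞,
      ∑' g, q g * f g = β * ∑ i, f (s i) + ∑' g, (q g - c g) * f g := by
    intro f
    rw [hsum, ← ENNReal.tsum_add]
    exact tsum_congr fun g => by rw [← add_mul, add_tsub_cancel_of_le (hc g)]
  refine ⟨β, fun g => q g - c g, (ENNReal.div_pos (hs i₀) (by simp)).ne', ?_, ?_, hsplit⟩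
  · simpa [mul_comm] using (hsplit fun _ => 1).symm
  · exact fun g hg h0 => hg (by simp [h0])

lemma tsum_mul_le_tsum_mul_add {α : Type*} {r f : α → ℝ≥0∞} {a b : ℝ≥0∞}
    (h : ∀ i, r i ≠ 0 → a ≤ f i + b) :
    (∑' i, r i) * a ≤ ∑' i, r i * f i + (∑' i, r i) * b := by
  rw [← ENNReal.tsum_mul_right, ← ENNReal.tsum_mul_right, ← ENNReal.tsum_add]
  refine ENNReal.tsum_le_tsum fun i => ?_
  rcases eq_or_ne (r i) 0 with hi | hi
  · simp [hi]
  · rw [← mul_add]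
    gcongr r i * ?_
    exact h i hi

end Splitting

section Drift

variable {G : Type*} [Group G] {X : Type*} [PseudoMetricSpace X] [MulAction G X]

/-- The mean distance from `y` to the `n`-th point of the walk issued from `o`. -/
def meanDist (p : PMF G) (o : X) (n : ℕ) (y : X) : ℝ≥0∞ :=
  ∫⁻ l, edist y (l.prod • o) ∂listLaw p n

lemma meanDist_zero (p : PMF G) (o y : X) : meanDist p o 0 y = edist y o := by
  rw [meanDist, lintegral_listLaw_zero, List.prod_nil, one_smul]

variable [IsIsometricSMul G X]

lemma edist_inv_smul (g : G) (x y : X) : edist (g⁻¹ • x) y = edist x (g • y) := by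
  rw [← edist_smul_left g (g⁻¹ • x), smul_inv_smul]

lemma meanDist_add (p : PMF G) (o : X) (m n : ℕ) (y : X) :
    meanDist p o (m + n) y = ∫⁻ l, meanDist p o n (l.prod⁻¹ • y) ∂listLaw p m := by
  simp only [meanDist, lintegral_listLaw_add, List.prod_append, mul_smul, edist_inv_smul]

lemma meanDist_succ (p : PMF G) (o : X) (n : ℕ) (y : X) :
    meanDist p o (n + 1) y = ∑' g, p g * meanDist p o n (g⁻¹ • y) := by
  simp only [meanDist, lintegral_listLaw_succ, List.prod_cons, mul_smul, edist_inv_smul]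

lemma meanDist_prodLaw (p : PMF G) (o : X) (k n : ℕ) (y : X) :
    meanDist (prodLaw p k) o n y = meanDist p o (k * n) y := by
  induction n generalizing y with
  | zero => simp only [meanDist_zero, mul_zero]
  | succ n ih =>
    rw [meanDist_succ, Nat.mul_succ, add_comm, meanDist_add,
      tsum_prodLaw_mul k fun g => meanDist (prodLaw p k) o n (g⁻¹ • y)]
    simp only [ih]

variable {ι : Type*} [Fintype ι] {q : PMF G} {s : ι → G} {β : ℝ≥0∞} {r : G → ℝ≥0∞} {o : X}

lemma IsSplitting.meanDist_succ (h : IsSplitting q s β r) (n : ℕ) (y : X) :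
    meanDist q o (n + 1) y =
      β * ∑ i, meanDist q o n ((s i)⁻¹ • y) + ∑' g, r g * meanDist q o n (g⁻¹ • y) := by
  rw [WPD.meanDist_succ, h.tsum_mul fun g => meanDist q o n (g⁻¹ • y)]

/-- Conditioning on the first of the `n` remaining steps being taken in the family `s`, the gain of
the family is collected once more; this happens with probability `card ι * β`. -/
lemma IsSplitting.card_mul_le_sum_meanDist (h : IsSplitting q s β r)
    (havg : ∀ y x : X, Fintype.card ι * (edist y o + 1) ≤ ∑ i, edist y (s i • x)) (n : ℕ) (y : X)
    (t : G) : Fintype.card ι * (edist y o + (1 + Fintype.card ι * β * n)) ≤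
      ∑ i, meanDist q o n ((s i * t)⁻¹ • y) := by
  set m : ℝ≥0∞ := (Fintype.card ι : ℝ≥0∞) with hm
  have havg' : ∀ (y : X) (t : G), m * (edist y o + 1) ≤ ∑ i, edist ((s i * t)⁻¹ • y) o :=
    fun y t => by simpa only [edist_inv_smul, mul_smul] using havg y (t • o)
  induction n generalizing y t with
  | zero => simpa only [meanDist_zero, Nat.cast_zero, mul_zero, add_zero] using havg' y t
  | succ n ih =>
    set b : ℝ≥0∞ := 1 + m * β * n with hb
    have hfamily : m * (m * (edist y o + 1)) + m * (m * b) ≤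
        ∑ i, ∑ j, meanDist q o n ((s j)⁻¹ • (s i * t)⁻¹ • y) := by
      calc m * (m * (edist y o + 1)) + m * (m * b)
          ≤ m * ∑ i, edist ((s i * t)⁻¹ • y) o + m * (m * b) := by gcongr; exact havg' y t
        _ = ∑ i, m * (edist ((s i * t)⁻¹ • y) o + b) := by
            simp only [mul_add, Finset.sum_add_distrib, ← Finset.mul_sum, Finset.sum_const,
              Finset.card_univ, nsmul_eq_mul, hm]
        _ ≤ _ := Finset.sum_le_sum fun i _ => by
            simpa only [mul_one] using ih ((s i * t)⁻¹ • y) 1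
    have hrest : (∑' g, r g) * (m * (edist y o + b)) ≤
        ∑' g, r g * ∑ i, meanDist q o n (g⁻¹ • (s i * t)⁻¹ • y) := by
      rw [← ENNReal.tsum_mul_right]
      refine ENNReal.tsum_le_tsum fun g => ?_
      gcongr
      simpa only [← mul_smul, ← mul_inv_rev, mul_assoc] using ih y (t * g)
    simp only [h.meanDist_succ, Finset.sum_add_distrib, ← Finset.mul_sum]
    rw [← Summable.tsum_finsetSum fun _ _ => ENNReal.summable]
    simp only [← Finset.mul_sum]
    calc m * (edist y o + (1 + m * β * (n + 1 : ℕ)))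
        = m * (edist y o + b) * (m * β + ∑' g, r g) + m * (m * β) := by
          rw [h.card_mul_add_tsum, hb]; push_cast; ring
      _ = β * (m * (m * (edist y o + 1)) + m * (m * b)) +
            (∑' g, r g) * (m * (edist y o + b)) := by ring
      _ ≤ _ := by gcongr

lemma IsSplitting.edist_add_le_meanDist_add (h : IsSplitting q s β r)
    (havg : ∀ y x : X, Fintype.card ι * (edist y o + 1) ≤ ∑ i, edist y (s i • x)) {R c : ℝ≥0∞}
    (hR : ∀ g ∈ q.support, edist o (g • o) ≤ R) (hc : R ≤ Fintype.card ι * β * c) (n : ℕ)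
    (y : X) : edist y o + Fintype.card ι * β * n ≤ meanDist q o n y + c := by
  set m : ℝ≥0∞ := (Fintype.card ι : ℝ≥0∞)
  have htotal : m * β + ∑' g, r g = 1 := h.card_mul_add_tsum
  induction n generalizing y with
  | zero => simp [meanDist_zero]
  | succ n ih =>
    have hfamily : m * (edist y o + (1 + m * β * n)) ≤
        ∑ i, meanDist q o n ((s i)⁻¹ • y) := by
      simpa only [mul_one] using h.card_mul_le_sum_meanDist havg n y 1
    have hstep : ∀ g, r g ≠ 0 → edist y o + m * β * n ≤
        meanDist q o n (g⁻¹ • y) + (R + c) := by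
      intro g hg
      calc edist y o + m * β * n ≤ edist (g⁻¹ • y) o + R + m * β * n := by
            gcongr ?_ + _
            rw [edist_inv_smul]
            exact (edist_triangle_right y o (g • o)).trans
              (add_le_add_right (hR g (h.mem_support g hg)) _)
        _ = edist (g⁻¹ • y) o + m * β * n + R := add_right_comm _ _ _
        _ ≤ meanDist q o n (g⁻¹ • y) + c + R := by gcongr ?_ + R; exact ih _
        _ = _ := by ring
    have hrest : (∑' g, r g) * (edist y o + m * β * n) ≤
        (∑' g, r g * meanDist q o n (g⁻¹ • y)) + (∑' g, r g) * (R + c) :=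
      tsum_mul_le_tsum_mul_add hstep
    have hconst : (∑' g, r g) * (R + c) ≤ c := by
      calc (∑' g, r g) * (R + c) = (∑' g, r g) * R + (∑' g, r g) * c := mul_add _ _ _
        _ ≤ m * β * c + (∑' g, r g) * c := by
            gcongr ?_ + _
            exact (mul_le_of_le_one_left bot_le (htotal ▸ le_add_self)).trans hc
        _ = c := by rw [← add_mul, htotal, one_mul]
    calc edist y o + m * β * (n + 1 : ℕ)
        = (edist y o + m * β * n) * (m * β + ∑' g, r g) + m * β := by
          rw [htotal]; push_cast; ring
      _ = β * (m * (edist y o + (1 + m * β * n))) +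
            (∑' g, r g) * (edist y o + m * β * n) := by ring
      _ ≤ β * ∑ i, meanDist q o n ((s i)⁻¹ • y) +
            ((∑' g, r g * meanDist q o n (g⁻¹ • y)) + (∑' g, r g) * (R + c)) := by gcongr
      _ ≤ meanDist q o (n + 1) y + c := by rw [h.meanDist_succ, add_assoc]; gcongr

lemma exists_edist_add_one_le_meanDist [Nonempty ι] (hs : ∀ i, s i ∈ q.support)
    (havg : ∀ y x : X, Fintype.card ι * (edist y o + 1) ≤ ∑ i, edist y (s i • x)) {R : ℝ≥0∞}
    (hR : ∀ g ∈ q.support, edist o (g • o) ≤ R) (hRtop : R ≠ ∞) :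
    ∃ n : ℕ, ∀ y : X, edist y o + 1 ≤ meanDist q o n y := by
  obtain ⟨β, r, h⟩ := exists_isSplitting q hs
  set κ : ℝ≥0∞ := Fintype.card ι * β
  have hκ : κ ≠ 0 := mul_ne_zero (by simp) h.ne_zero
  have hκtop : κ ≠ ∞ :=
    ne_top_of_le_ne_top ENNReal.one_ne_top (h.card_mul_add_tsum ▸ le_self_add)
  have hc : R / κ ≠ ∞ := ENNReal.div_ne_top hRtop hκ
  obtain ⟨n, hn⟩ := ENNReal.exists_nat_mul_gt hκ (b := 1 + R / κ) (by simp [hc])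
  refine ⟨n, fun y => (ENNReal.add_le_add_iff_right hc).1 ?_⟩
  calc edist y o + 1 + R / κ = edist y o + (1 + R / κ) := add_assoc _ _ _
    _ ≤ edist y o + κ * n := by rw [mul_comm κ]; gcongr
    _ ≤ meanDist q o n y + R / κ :=
      h.edist_add_le_meanDist_add havg hR (ENNReal.mul_div_cancel hκ hκtop).ge n y

lemma edist_smul_le_of_mem_support_prodLaw {p : PMF G} {R : ℝ}
    (hR : ∀ g ∈ p.support, dist o (g • o) ≤ R) {k : ℕ} {g : G} (hg : g ∈ (prodLaw p k).support) :
    edist o (g • o) ≤ ENNReal.ofReal (k * R) := by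
  obtain ⟨l, ⟨rfl, hl⟩, rfl⟩ := mem_support_prodLaw.1 hg
  rw [edist_dist]
  exact ENNReal.ofReal_le_ofReal (dist_list_prod_smul_le fun a ha => hR a (hl a ha))

lemma IsSchottky.exists_edist_add_one_le_meanDist {p : PMF G} {δ C D R : ℝ} {k : ℕ}
    (hδ : FourPointCondition X δ) (hs : IsSchottky o C D s) (hC : 0 ≤ C)
    (hD : 8 * C + 4 * δ + 2 ≤ D) (hcard : 12 ≤ Fintype.card ι)
    (hmem : ∀ i, s i ∈ (prodLaw p k).support) (hR : ∀ g ∈ p.support, dist o (g • o) ≤ R) :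
    ∃ n : ℕ, 0 < n ∧ ∀ y : X, edist y o + 1 ≤ meanDist p o n y := by
  have havg : ∀ y x : X, Fintype.card ι * (edist y o + 1) ≤ ∑ i, edist y (s i • x) := by
    intro y x
    have h := ENNReal.ofReal_le_ofReal (hs.card_mul_le_sum_dist hδ hC hD hcard y x)
    rw [ENNReal.ofReal_sum_of_nonneg fun _ _ => dist_nonneg, ENNReal.ofReal_mul (by positivity),
      ENNReal.ofReal_add dist_nonneg zero_le_one, ENNReal.ofReal_natCast,
      ENNReal.ofReal_one] at h
    simpa only [edist_dist] using h
  have : Nonempty ι := Fintype.card_pos_iff.1 (by omega)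
  obtain ⟨n, hn⟩ := WPD.exists_edist_add_one_le_meanDist hmem havg
    (fun g hg => edist_smul_le_of_mem_support_prodLaw hR hg) ENNReal.ofReal_ne_top
  simp only [meanDist_prodLaw] at hn
  refine ⟨k * n, Nat.pos_of_ne_zero fun h0 => ?_, hn⟩
  have h := hn o
  rw [h0, meanDist_zero, edist_self, zero_add] at h
  exact one_ne_zero (le_zero_iff.1 h)

end Drift

section Contraction

variable {G : Type*} [Group G] {X : Type*} [PseudoMetricSpace X] [MulAction G X]

/-- The Laplace transform `𝔼 exp (-ε d(y, w_n o))` of the distance from `y` to the `n`-th point of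
the walk issued from `o`. -/
def meanExpDist (p : PMF G) (o : X) (ε : ℝ) (n : ℕ) (y : X) : ℝ≥0∞ :=
  ∫⁻ l, ENNReal.ofReal (Real.exp (-ε * dist y (l.prod • o))) ∂listLaw p n

/-- Exponential decay of the walk away from any point: `𝔼 exp (-ε d(y, w_n o))` is at most
`A lamⁿ exp (-ε d(y, o))`. -/
structure HasExpDecay (p : PMF G) (o : X) (ε A lam : ℝ) : Prop where
  rate_pos : 0 < ε
  const_pos : 0 < A
  base_pos : 0 < lam
  base_lt_one : lam < 1
  meanExpDist_le (n : ℕ) (y : X) :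
    meanExpDist p o ε n y ≤ ENNReal.ofReal (A * lam ^ n * Real.exp (-ε * dist y o))

variable {p : PMF G} {o : X} {ε R : ℝ}

lemma HasExpDecay.listLaw_dist_le {A lam : ℝ} (h : HasExpDecay p o ε A lam) (n : ℕ) (y : X)
    (r : ℝ) : listLaw p n {l | dist y (l.prod • o) ≤ r} ≤
      ENNReal.ofReal (A * lam ^ n * Real.exp (-ε * (dist y o - r))) := by
  have hevent : {l : List G | ENNReal.ofReal (Real.exp (-ε * r)) ≤
      ENNReal.ofReal (Real.exp (-ε * dist y (l.prod • o)))} = {l | dist y (l.prod • o) ≤ r} := by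
    ext l
    simp only [Set.mem_ofPred_eq, ENNReal.ofReal_le_ofReal_iff (Real.exp_pos _).le,
      Real.exp_le_exp, neg_mul, neg_le_neg_iff, mul_le_mul_iff_right₀ h.rate_pos]
  have hexp : A * lam ^ n * Real.exp (-ε * dist y o) =
      Real.exp (-ε * r) * (A * lam ^ n * Real.exp (-ε * (dist y o - r))) := by
    rw [mul_left_comm, ← Real.exp_add]
    congr 2
    ring
  have hmarkov := (mul_meas_ge_le_lintegral (μ := listLaw p n) Measurable.of_discrete
    (ENNReal.ofReal (Real.exp (-ε * r)))).trans (h.meanExpDist_le n y)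
  rw [hevent, hexp, ENNReal.ofReal_mul (Real.exp_pos _).le] at hmarkov
  exact (ENNReal.mul_le_mul_iff_right (by simpa using Real.exp_pos _) ENNReal.ofReal_ne_top).1
    hmarkov

lemma meanExpDist_zero (p : PMF G) (o : X) (ε : ℝ) (y : X) :
    meanExpDist p o ε 0 y = ENNReal.ofReal (Real.exp (-ε * dist y o)) := by
  rw [meanExpDist, lintegral_listLaw_zero, List.prod_nil, one_smul]

lemma exp_neg_mul_add_mul_le {ε B d d₀ : ℝ} (hε : 0 ≤ ε) (hB : 1 ≤ B) (hεB : ε * B ^ 2 ≤ 1 / 2)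
    (hd : |d - d₀| ≤ B) : Real.exp (-ε * (d - d₀)) + ε * d ≤ 1 + ε / 2 + ε * d₀ := by
  have hsmall : |-ε * (d - d₀)| ≤ 1 := by
    calc |-ε * (d - d₀)| = ε * |d - d₀| := by rw [abs_mul, abs_neg, abs_of_nonneg hε]
      _ ≤ ε * B ^ 2 := by gcongr; exact hd.trans (le_self_pow₀ hB two_ne_zero)
      _ ≤ 1 := by linarith
  have htaylor := (abs_le.1 (Real.abs_exp_sub_one_sub_id_le hsmall)).2
  have hsq : (-ε * (d - d₀)) ^ 2 ≤ ε / 2 := by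
    calc (-ε * (d - d₀)) ^ 2 = ε * (ε * |d - d₀| ^ 2) := by rw [sq_abs]; ring
      _ ≤ ε * (ε * B ^ 2) := by gcongr
      _ ≤ ε * (1 / 2) := by gcongr
      _ = ε / 2 := by ring
  linarith

lemma nonneg_of_forall_mem_support (hR : ∀ g ∈ p.support, dist o (g • o) ≤ R) : 0 ≤ R :=
  p.support_nonempty.elim fun g hg => dist_nonneg.trans (hR g hg)

variable [IsIsometricSMul G X]

lemma meanExpDist_add (p : PMF G) (o : X) (ε : ℝ) (m n : ℕ) (y : X) :
    meanExpDist p o ε (m + n) y =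
      ∫⁻ l, meanExpDist p o ε n (l.prod⁻¹ • y) ∂listLaw p m := by
  simp only [meanExpDist, lintegral_listLaw_add, List.prod_append, mul_smul, dist_inv_smul]

lemma ae_dist_le (hR : ∀ g ∈ p.support, dist o (g • o) ≤ R) (n : ℕ) :
    ∀ᵐ l ∂listLaw p n, dist o (l.prod • o) ≤ n * R := by
  filter_upwards [ae_listLaw p n] with l hl
  exact hl.1 ▸ dist_list_prod_smul_le fun g hg => hR g (hl.2 g hg)

/-- By Taylor's formula, the drift of the distance dominates its second moment for small `ε`. -/
lemma meanExpDist_le_of_edist_add_one_le (hR : ∀ g ∈ p.support, dist o (g • o) ≤ R) {n : ℕ}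
    {B : ℝ} (hnR : n * R ≤ B) (hB : 1 ≤ B) (hε : 0 ≤ ε) (hεB : ε * B ^ 2 ≤ 1 / 2) {y : X}
    (hdrift : edist y o + 1 ≤ meanDist p o n y) :
    meanExpDist p o ε n y ≤ ENNReal.ofReal ((1 - ε / 2) * Real.exp (-ε * dist y o)) := by
  have hε1 : ε ≤ 1 / 2 := (le_mul_of_one_le_right hε (one_le_pow₀ hB)).trans hεB
  set E : ℝ≥0∞ := ∫⁻ l, ENNReal.ofReal (Real.exp (-ε * (dist y (l.prod • o) - dist y o)))
    ∂listLaw p n with hE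
  have htaylor : E + ENNReal.ofReal ε * meanDist p o n y ≤
      ENNReal.ofReal (1 + ε / 2 + ε * dist y o) := by
    rw [hE, meanDist, ← lintegral_const_mul _ Measurable.of_discrete,
      ← lintegral_add_left Measurable.of_discrete]
    refine lintegral_le_const ?_
    filter_upwards [ae_dist_le hR n] with l hl
    rw [edist_dist, ← ENNReal.ofReal_mul hε,
      ← ENNReal.ofReal_add (Real.exp_pos _).le (by positivity)]
    refine ENNReal.ofReal_le_ofReal (exp_neg_mul_add_mul_le hε hB hεB ?_)
    rw [dist_comm y, dist_comm y]
    exact (abs_dist_sub_le _ _ _).trans ((dist_comm _ _).trans_le (hl.trans hnR))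
  have hgain : ENNReal.ofReal (ε * dist y o + ε) ≤ ENNReal.ofReal ε * meanDist p o n y := by
    calc ENNReal.ofReal (ε * dist y o + ε) = ENNReal.ofReal ε * (edist y o + 1) := by
          rw [edist_dist, ← ENNReal.ofReal_one, ← ENNReal.ofReal_add dist_nonneg zero_le_one,
            ← ENNReal.ofReal_mul hε, mul_add, mul_one]
      _ ≤ _ := by gcongr
  have hcontract : E ≤ ENNReal.ofReal (1 - ε / 2) := by
    refine (ENNReal.add_le_add_iff_right ENNReal.ofReal_ne_top).1
      (((add_le_add_right hgain E).trans htaylor).trans_eq ?_)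
    rw [← ENNReal.ofReal_add (by linarith) (by positivity)]
    congr 1
    ring
  calc meanExpDist p o ε n y = ENNReal.ofReal (Real.exp (-ε * dist y o)) * E := by
        rw [hE, meanExpDist, ← lintegral_const_mul _ Measurable.of_discrete]
        refine lintegral_congr fun l => ?_
        rw [← ENNReal.ofReal_mul (Real.exp_pos _).le, ← Real.exp_add]
        congr 2
        ring
    _ ≤ ENNReal.ofReal (Real.exp (-ε * dist y o)) * ENNReal.ofReal (1 - ε / 2) := by gcongr
    _ = _ := by rw [← ENNReal.ofReal_mul (Real.exp_pos _).le, mul_comm]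

lemma exists_meanExpDist_le (hR : ∀ g ∈ p.support, dist o (g • o) ≤ R) {n : ℕ}
    (hdrift : ∀ y : X, edist y o + 1 ≤ meanDist p o n y) :
    ∃ ε ρ : ℝ, 0 < ε ∧ 0 < ρ ∧ ρ < 1 ∧ ∀ y : X,
      meanExpDist p o ε n y ≤ ENNReal.ofReal (ρ * Real.exp (-ε * dist y o)) := by
  have hR0 := nonneg_of_forall_mem_support hR
  set B : ℝ := n * R + 1
  have hB : 1 ≤ B := le_add_of_nonneg_left (by positivity)
  set ε : ℝ := 1 / (2 * B ^ 2) with hε_def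
  have hε : 0 < ε := by positivity
  have hεB : ε * B ^ 2 ≤ 1 / 2 := by rw [hε_def]; field_simp; exact le_rfl
  have hε1 : ε ≤ 1 / 2 := (le_mul_of_one_le_right hε.le (one_le_pow₀ hB)).trans hεB
  exact ⟨ε, 1 - ε / 2, hε, by linarith, by linarith, fun y =>
    meanExpDist_le_of_edist_add_one_le hR (le_add_of_nonneg_right zero_le_one) hB hε.le hεB
      (hdrift y)⟩

lemma meanExpDist_mul_le {ρ : ℝ} (hρ : 0 ≤ ρ) {n : ℕ} (h : ∀ y : X,
    meanExpDist p o ε n y ≤ ENNReal.ofReal (ρ * Real.exp (-ε * dist y o))) (q : ℕ) (y : X) :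
    meanExpDist p o ε (n * q) y ≤ ENNReal.ofReal (ρ ^ q * Real.exp (-ε * dist y o)) := by
  induction q generalizing y with
  | zero => simp only [mul_zero, meanExpDist_zero, pow_zero, one_mul, le_refl]
  | succ q ih =>
    rw [Nat.mul_succ, add_comm, meanExpDist_add]
    calc ∫⁻ l, meanExpDist p o ε (n * q) (l.prod⁻¹ • y) ∂listLaw p n
        ≤ ∫⁻ l, ENNReal.ofReal (ρ ^ q) *
            ENNReal.ofReal (Real.exp (-ε * dist y (l.prod • o))) ∂listLaw p n := by
          refine lintegral_mono fun l => ?_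
          rw [← ENNReal.ofReal_mul (pow_nonneg hρ q), ← dist_inv_smul]
          exact ih _
      _ = ENNReal.ofReal (ρ ^ q) * meanExpDist p o ε n y :=
          lintegral_const_mul _ Measurable.of_discrete
      _ ≤ ENNReal.ofReal (ρ ^ q) * ENNReal.ofReal (ρ * Real.exp (-ε * dist y o)) := by
          gcongr
          exact h y
      _ = _ := by rw [← ENNReal.ofReal_mul (pow_nonneg hρ q), pow_succ, mul_assoc]

lemma meanExpDist_add_le (hR : ∀ g ∈ p.support, dist o (g • o) ≤ R) (hε : 0 ≤ ε) {c : ℝ}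
    (hc : 0 ≤ c) {n : ℕ}
    (h : ∀ y : X, meanExpDist p o ε n y ≤ ENNReal.ofReal (c * Real.exp (-ε * dist y o))) (m : ℕ)
    (y : X) : meanExpDist p o ε (m + n) y ≤
      ENNReal.ofReal (Real.exp (ε * (m * R)) * c * Real.exp (-ε * dist y o)) := by
  rw [meanExpDist_add]
  refine lintegral_le_const ?_
  filter_upwards [ae_dist_le hR m] with l hl
  refine (h _).trans (ENNReal.ofReal_le_ofReal ?_)
  have htriangle := dist_triangle_right y o (l.prod • o)
  calc c * Real.exp (-ε * dist (l.prod⁻¹ • y) o)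
      ≤ c * Real.exp (ε * (m * R) + -ε * dist y o) := by
        rw [dist_inv_smul]
        gcongr
        nlinarith
    _ = _ := by rw [Real.exp_add]; ring

lemma exists_hasExpDecay (hR : ∀ g ∈ p.support, dist o (g • o) ≤ R) {n : ℕ} (hn : 0 < n)
    (hdrift : ∀ y : X, edist y o + 1 ≤ meanDist p o n y) :
    ∃ ε A lam : ℝ, HasExpDecay p o ε A lam := by
  obtain ⟨ε, ρ, hε, hρ0, hρ1, h⟩ := exists_meanExpDist_le hR hdrift
  have hR0 := nonneg_of_forall_mem_support hR
  set lam : ℝ := ρ ^ ((n : ℝ)⁻¹)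
  have hlam_pow : lam ^ n = ρ := Real.rpow_inv_natCast_pow hρ0.le hn.ne'
  have hlam0 : 0 < lam := Real.rpow_pos_of_pos hρ0 _
  have hlam1 : lam < 1 := Real.rpow_lt_one hρ0.le hρ1 (by positivity)
  refine ⟨ε, Real.exp (ε * (n * R)) / ρ, lam, hε, by positivity, hlam0, hlam1, fun m y => ?_⟩
  have hmod : m % n ≤ n := (Nat.mod_lt m hn).le
  have hpow : ρ ^ (m / n) ≤ lam ^ m / ρ := by
    rw [le_div_iff₀ hρ0, ← pow_succ, ← hlam_pow, ← pow_mul]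
    refine pow_le_pow_of_le_one hlam0.le hlam1.le ?_
    have := Nat.mod_add_div m n
    rw [Nat.mul_succ]
    omega
  calc meanExpDist p o ε m y = meanExpDist p o ε (m % n + n * (m / n)) y := by
        rw [Nat.mod_add_div]
    _ ≤ ENNReal.ofReal (Real.exp (ε * ((m % n : ℕ) * R)) * ρ ^ (m / n) *
          Real.exp (-ε * dist y o)) :=
        meanExpDist_add_le hR hε.le (by positivity) (meanExpDist_mul_le hρ0.le h (m / n)) _ y
    _ ≤ ENNReal.ofReal (Real.exp (ε * (n * R)) * (lam ^ m / ρ) * Real.exp (-ε * dist y o)) := by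
        gcongr
    _ = _ := by rw [mul_div_left_comm, mul_comm (lam ^ m)]

end Contraction

section Crossing

/-- Halving the path, each of the `k` halvings costs one application of the four-point condition. -/
lemma FourPointCondition.sub_le_gromovProduct_of_path {X : Type*} [PseudoMetricSpace X] {δ a : ℝ}
    (hδ : FourPointCondition X δ) {w : X} {x : ℕ → X} (hdist : ∀ j, a ≤ dist w (x j))
    (hstep : ∀ j, a ≤ gromovProduct w (x j) (x (j + 1))) (k i n : ℕ) (hn : n ≤ 2 ^ k) :
    a - k * δ ≤ gromovProduct w (x i) (x (i + n)) := by
  induction k generalizing i n with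
  | zero =>
    obtain rfl | rfl : n = 0 ∨ n = 1 := by rw [pow_zero] at hn; omega
    · simpa [gromovProduct] using hdist i
    · simpa using hstep i
  | succ k ih =>
    rw [pow_succ] at hn
    have hleft := ih i (n / 2) (by omega)
    have hright := ih (i + n / 2) (n - n / 2) (by omega)
    rw [add_assoc, Nat.add_sub_cancel' (Nat.div_le_self n 2)] at hright
    push_cast
    rcases min_le_iff.1 (hδ w (x i) (x (i + n / 2)) (x (i + n))) with h | h <;> linarith

lemma IsGromovHyperbolic.exists_gromovProduct_eq {X : Type*} [MetricSpace X]
    (hX : IsGromovHyperbolic X) {o y : X} {r : ℝ} (hr0 : 0 ≤ r) (hr : r ≤ dist o y) :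
    ∃ y', dist o y' = r ∧ gromovProduct o y' y = r := by
  obtain ⟨s, hs⟩ := hX.geodesic o y
  obtain ⟨y', hy's, hy'⟩ := hs.exists_dist_eq hr0 hr
  refine ⟨y', hy', ?_⟩
  have := hs.dist_add_dist hy's
  rw [gromovProduct]
  linarith

/-- A walk whose endpoint is seen from `o` behind `y'` passes close to `y'`: otherwise `y'` would
not separate `o` from the endpoint. -/
lemma FourPointCondition.exists_dist_take_prod_smul_le {G X : Type*} [Group G]
    [PseudoMetricSpace X] [MulAction G X] [IsIsometricSMul G X] {δ R r : ℝ}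
    (hδ : FourPointCondition X δ) {o y y' : X} (hy' : dist o y' = r)
    (hgp : gromovProduct o y' y = r) {l : List G} (hR0 : 0 ≤ R)
    (hl : ∀ g ∈ l, dist o (g • o) ≤ R) {k : ℕ} (hk : l.length ≤ 2 ^ k)
    (hr : k * δ + δ + R < r / 2) (hly : r ≤ gromovProduct o y (l.prod • o)) :
    ∃ j ≤ l.length, dist y' ((l.take j).prod • o) ≤ r / 2 := by
  by_contra! hfar_le
  have hfar : ∀ j, r / 2 < dist y' ((l.take j).prod • o) := by
    intro j
    rcases le_total j l.length with hj | hj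
    · exact hfar_le j hj
    · simpa only [List.take_of_length_le hj, List.take_length] using hfar_le _ le_rfl
  have hstep : ∀ j, dist ((l.take j).prod • o) ((l.take (j + 1)).prod • o) ≤ R := by
    intro j
    rw [List.take_add_one, List.prod_append, mul_smul, dist_smul]
    rcases hj : l[j]? with _ | g
    · simpa using hR0
    · simpa using hl g (List.mem_of_getElem? hj)
  have hpath := hδ.sub_le_gromovProduct_of_path (w := y') (x := fun j => (l.take j).prod • o)
    (a := r / 2 - R) (fun j => by linarith [hfar j])
    (fun j => by
      have := dist_sub_dist_le_gromovProduct y' ((l.take j).prod • o) ((l.take (j + 1)).prod • o)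
      linarith [hfar j, hstep j]) k 0 l.length hk
  simp only [zero_add, List.take_zero, List.prod_nil, one_smul, List.take_length] at hpath
  have hsum := gromovProduct_add_gromovProduct o y' (l.prod • o)
  have hmin : r ≤ gromovProduct o y' (l.prod • o) + δ :=
    (le_min hgp.ge hly).trans (hδ o y' y (l.prod • o))
  linarith

lemma HasExpDecay.listLaw_le_gromovProduct_le {G X : Type*} [Group G] [MetricSpace X]
    [MulAction G X] [IsIsometricSMul G X] {δ R r : ℝ} (hX : IsGromovHyperbolic X)
    (hδ : FourPointCondition X δ) {p : PMF G} {o : X} (hR : ∀ g ∈ p.support, dist o (g • o) ≤ R)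
    {ε A lam : ℝ} (h : HasExpDecay p o ε A lam) {n k : ℕ} (hn : n ≤ 2 ^ k) (hr0 : 0 ≤ r)
    (hr : k * δ + δ + R < r / 2) (y : X) :
    listLaw p n {l | r ≤ gromovProduct o y (l.prod • o)} ≤
      ENNReal.ofReal ((n + 1) * (A * Real.exp (-ε * (r / 2)))) := by
  rcases lt_or_ge (dist o y) r with hy | hy
  · have hempty : {l : List G | r ≤ gromovProduct o y (l.prod • o)} = ∅ :=
      Set.eq_empty_of_forall_notMem fun l hl =>
        ((gromovProduct_le_dist_left o y (l.prod • o)).trans_lt hy).not_ge hl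
    rw [hempty, measure_empty]
    exact bot_le
  obtain ⟨y', hy', hgp⟩ := hX.exists_gromovProduct_eq hr0 hy
  have hprefix : ∀ j ∈ Finset.range (n + 1),
      listLaw p n {l | dist y' ((l.take j).prod • o) ≤ r / 2} ≤
        ENNReal.ofReal (A * Real.exp (-ε * (r / 2))) := by
    intro j hj
    refine (listLaw_take (Nat.lt_succ_iff.1 (Finset.mem_range.1 hj))
      {l | dist y' (l.prod • o) ≤ r / 2}).trans_le ((h.listLaw_dist_le j y' _).trans ?_)
    refine ENNReal.ofReal_le_ofReal ?_
    rw [dist_comm y' o, hy', sub_half]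
    gcongr
    exact mul_le_of_le_one_right h.const_pos.le (pow_le_one₀ h.base_pos.le h.base_lt_one.le)
  calc listLaw p n {l | r ≤ gromovProduct o y (l.prod • o)}
      ≤ listLaw p n (⋃ j ∈ Finset.range (n + 1),
          {l | dist y' ((l.take j).prod • o) ≤ r / 2}) := by
        refine measure_mono_ae ?_
        filter_upwards [ae_listLaw p n] with l ⟨hln, hl⟩ hly
        obtain ⟨j, hj, hclose⟩ := hδ.exists_dist_take_prod_smul_le hy' hgp
          (nonneg_of_forall_mem_support hR) (fun g hg => hR g (hl g hg)) (hln ▸ hn) hr hly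
        exact Set.mem_biUnion (Finset.mem_range.2 (by omega)) hclose
    _ ≤ ∑ j ∈ Finset.range (n + 1), listLaw p n {l | dist y' ((l.take j).prod • o) ≤ r / 2} :=
        measure_biUnion_finset_le _ _
    _ ≤ (n + 1 : ℕ) * ENNReal.ofReal (A * Real.exp (-ε * (r / 2))) := by
        refine (Finset.sum_le_card_nsmul _ _ _ hprefix).trans_eq ?_
        rw [Finset.card_range, nsmul_eq_mul]
    _ = _ := by
        rw [← ENNReal.ofReal_natCast, ← ENNReal.ofReal_mul (Nat.cast_nonneg _), Nat.cast_succ]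

end Crossing

section Trials

variable {G : Type*} {p : PMF G} {θ : ℝ≥0∞} {Bad : List G → List G → Prop}

lemma listLaw_take_mem_and_le {m n k : ℕ} (hk : k = m + n)
    (h : ∀ l, listLaw p n {l' | Bad l l'} ≤ θ) (E : Set (List G)) :
    listLaw p k {l | l.take m ∈ E ∧ Bad (l.take m) (l.drop m)} ≤ listLaw p m E * θ := by
  rw [hk, listLaw_add_take_drop m n fun l l' => l ∈ E ∧ Bad l l',
    ← lintegral_indicator_one (.of_discrete : MeasurableSet E),
    ← lintegral_mul_const _ Measurable.of_discrete]
  refine lintegral_mono fun l => ?_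
  by_cases hl : l ∈ E
  · simpa [hl] using h l
  · simp [hl]

lemma listLaw_forall_trials_le {b : ℕ} (h : ∀ l, listLaw p b {l' | Bad l l'} ≤ θ) (a L : ℕ)
    {n : ℕ} (hn : a + b * L ≤ n) :
    listLaw p n {l | ∀ i < L, Bad (l.take (a + b * i)) ((l.drop (a + b * i)).take b)} ≤
      θ ^ L := by
  induction L generalizing n with
  | zero => simp only [pow_zero, prob_le_one]
  | succ L ih =>
    rw [Nat.mul_succ, ← add_assoc] at hn
    set m := a + b * L with hm
    let E : Set (List G) :=
      {l | ∀ i < L, Bad (l.take (a + b * i)) ((l.drop (a + b * i)).take b)}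
    have htrial : ∀ l, listLaw p (n - m) {l' | Bad l (l'.take b)} ≤ θ := fun l =>
      (listLaw_take (Nat.le_sub_of_add_le' hn) {l' | Bad l l'}).trans_le (h l)
    have hstep := listLaw_take_mem_and_le (p := p) (k := n) (Nat.add_sub_cancel' (by omega)).symm
      htrial E
    rw [pow_succ]
    refine (measure_mono fun l hl => ?_).trans (hstep.trans (by gcongr; exact ih hm.ge))
    refine ⟨fun i hi => ?_, hl L L.lt_succ_self⟩
    have hblock : a + b * i + b ≤ m := by
      rw [add_assoc, ← Nat.mul_succ]
      exact Nat.add_le_add_left (Nat.mul_le_mul_left b hi) a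
    rw [List.take_take, List.drop_take, List.take_take, min_eq_left (by omega),
      min_eq_left (by omega)]
    exact hl i (hi.trans L.lt_succ_self)

end Trials

section Insertion

variable {G : Type*} [Group G] {X : Type*} [PseudoMetricSpace X] [MulAction G X] {ι : Type*}
  {o : X} {C D : ℝ} {s : ι → G}

/-- The element `g` is of the form `s i * H * s j`, and in the product `u * s i * H * s j * v` no
two consecutive factors backtrack by more than `C`. -/
def IsAlignedInsertion (o : X) (C : ℝ) (s : ι → G) (H u g v : G) : Prop :=
  ∃ i j, g = s i * H * s j ∧
    gromovProduct o (u⁻¹ • o) (s i • o) ≤ C ∧ gromovProduct o ((s i)⁻¹ • o) (H • o) ≤ C ∧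
    gromovProduct o (H⁻¹ • o) (s j • o) ≤ C ∧ gromovProduct o ((s j)⁻¹ • o) (v • o) ≤ C

variable [Fintype ι]

lemma IsSchottky.exists_gromovProduct_le (hs : IsSchottky o C D s) (hcard : 3 ≤ Fintype.card ι)
    (x y : X) : ∃ i, gromovProduct o y (s i • o) ≤ C ∧ gromovProduct o ((s i)⁻¹ • o) x ≤ C := by
  classical
  by_contra! hbad
  have hall := hs.card_filter_le x y
  rw [Finset.filter_true_of_mem, Finset.card_univ] at hall
  · omega
  · intro i _
    rw [gromovProduct_comm o x]
    exact (lt_or_ge C _).imp_right fun h => hbad i h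

lemma IsSchottky.exists_isAlignedInsertion (hs : IsSchottky o C D s)
    (hcard : 3 ≤ Fintype.card ι) (H u v : G) :
    ∃ i j, IsAlignedInsertion o C s H u (s i * H * s j) v := by
  obtain ⟨i, hui, hiH⟩ := hs.exists_gromovProduct_le hcard (H • o) (u⁻¹ • o)
  obtain ⟨j, hHj, hjv⟩ := hs.exists_gromovProduct_le hcard (v • o) (H⁻¹ • o)
  exact ⟨i, j, i, j, rfl, hui, hiH, hHj, hjv⟩

lemma IsSchottky.exists_listLaw_not_isAlignedInsertion_le (hs : IsSchottky o C D s)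
    (hcard : 3 ≤ Fintype.card ι) {p : PMF G} {k : ℕ} {H : G}
    (hmem : ∀ i j, s i * H * s j ∈ (prodLaw p k).support) :
    ∃ θ < 1, ∀ u v, listLaw p k {l | ¬ IsAlignedInsertion o C s H u l.prod v} ≤ θ := by
  have : Nonempty ι := Fintype.card_pos_iff.1 (by omega)
  obtain ⟨⟨i₀, j₀⟩, hmin⟩ := Finite.exists_min fun x : ι × ι => prodLaw p k (s x.1 * H * s x.2)
  set α := prodLaw p k (s i₀ * H * s j₀)
  have hα : α ≠ 0 := (PMF.mem_support_iff _ _).1 (hmem i₀ j₀)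
  refine ⟨1 - α, ENNReal.sub_lt_self ENNReal.one_ne_top one_ne_zero hα, fun u v => ?_⟩
  obtain ⟨i, j, hij⟩ := hs.exists_isAlignedInsertion hcard H u v
  set aligned := {l : List G | IsAlignedInsertion o C s H u l.prod v}
  have hfail : listLaw p k alignedᶜ = 1 - listLaw p k aligned := prob_compl_eq_one_sub .of_discrete
  refine hfail.trans_le (tsub_le_tsub_left ?_ 1)
  calc α ≤ prodLaw p k (s i * H * s j) := hmin (i, j)
    _ = listLaw p k {l | l.prod = s i * H * s j} := prodLaw_apply k _
    _ ≤ listLaw p k aligned := measure_mono fun l (hl : l.prod = _) =>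
        show IsAlignedInsertion o C s H u l.prod v from hl ▸ hij

end Insertion

section Estimate

variable {G : Type*} [Group G] {X : Type*} [MetricSpace X] [MulAction G X] [IsIsometricSMul G X]
  {p : PMF G} {δ R ε A lam r : ℝ} {o : X}

/-- The exceptional event at scale `r`: one of `u`, `v`, `z` is shorter than `4 * r`, or one of the
products `z * u`, `v * z` backtracks by at least `r`. -/
def IsDegenerate (o : X) (r : ℝ) (u v z : G) : Prop :=
  dist o (u • o) ≤ 4 * r ∨ dist o (v • o) ≤ 4 * r ∨ dist o (z • o) ≤ 4 * r ∨
    r ≤ gromovProduct o (z⁻¹ • o) (u • o) ∨ r ≤ gromovProduct o (v⁻¹ • o) (z • o)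

lemma isWPD_of_isAlignedInsertion {ι : Type*} (hδ : FourPointCondition X δ) {C D : ℝ} {s : ι → G}
    (hs : IsSchottky o C D s) (hC : 0 ≤ C) (hD : 2 * C + 3 * δ + 1 ≤ D)
    (hr : C + 3 * δ + 1 ≤ r) {H : G} (hH : 2 * C + 3 * δ + 1 ≤ dist o (H • o))
    (hfin : (jointCoarseStab G (2 * C + 10 * δ + 1) o (H • o)).Finite) {u g v z : G}
    (hg : IsAlignedInsertion o C s H u g v) (hdeg : ¬ IsDegenerate o r u v z) :
    IsWPD X (u * g * v * z) := by
  obtain ⟨i, j, rfl, hui, hiH, hHj, hjv⟩ := hg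
  simp only [IsDegenerate, not_or, not_le] at hdeg
  obtain ⟨hu, hv, hz, hzu, hvz⟩ := hdeg
  have := hδ.nonneg o
  simpa only [mul_assoc] using isWPD_of_aligned hδ hC (by linarith) hzu.le hui hiH hHj hjv hvz.le
    (by linarith) (hD.trans (hs.le_dist i)) hH (hD.trans (hs.le_dist j)) (by linarith)
    (by linarith) hfin

lemma HasExpDecay.listLaw_dist_smul_le {X : Type*} [PseudoMetricSpace X] [MulAction G X] {o : X}
    (h : HasExpDecay p o ε A lam) {m n : ℕ} (hmn : m ≤ n) (d : ℝ) :
    listLaw p n {l | dist o (l.prod • o) ≤ d} ≤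
      ENNReal.ofReal (A * lam ^ m * Real.exp (ε * d)) := by
  refine (h.listLaw_dist_le n o d).trans (ENNReal.ofReal_le_ofReal ?_)
  have := h.const_pos
  rw [dist_self, zero_sub, neg_mul_neg]
  gcongr A * ?_ * _
  exact pow_le_pow_of_le_one h.base_pos.le h.base_lt_one.le hmn

lemma HasExpDecay.listLaw_le_gromovProduct_le_of_le (hX : IsGromovHyperbolic X)
    (hδ : FourPointCondition X δ) (hR : ∀ g ∈ p.support, dist o (g • o) ≤ R)
    (h : HasExpDecay p o ε A lam) {n K : ℕ} (hn : n ≤ 2 ^ K) (hr0 : 0 ≤ r)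
    (hr : K * δ + δ + R < r / 2) {j : ℕ} (hj : j ≤ n) (y : X) :
    listLaw p j {l | r ≤ gromovProduct o y (l.prod • o)} ≤
      ENNReal.ofReal ((n + 1) * (A * Real.exp (-ε * (r / 2)))) := by
  refine (h.listLaw_le_gromovProduct_le hX hδ hR (hj.trans hn) hr0 hr y).trans
    (ENNReal.ofReal_le_ofReal ?_)
  have := h.const_pos
  gcongr

lemma HasExpDecay.listLaw_isDegenerate_le (hX : IsGromovHyperbolic X)
    (hδ : FourPointCondition X δ) (hR : ∀ g ∈ p.support, dist o (g • o) ≤ R)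
    (h : HasExpDecay p o ε A lam) {n K : ℕ} (hn : n ≤ 2 ^ K) (hr0 : 0 ≤ r)
    (hr : K * δ + δ + R < r / 2) {a k m : ℕ} (hma : m ≤ a) (hsum : a + k + m + m ≤ n) :
    listLaw p n {l | IsDegenerate o r (l.take a).prod ((l.drop (a + k)).take m).prod
      (l.drop (a + k + m)).prod} ≤
      3 * ENNReal.ofReal (A * lam ^ m * Real.exp (ε * (4 * r))) +
        2 * ENNReal.ofReal ((n + 1) * (A * Real.exp (-ε * (r / 2)))) := by
  have hshort : ∀ j, m ≤ j → listLaw p j {l | dist o (l.prod • o) ≤ 4 * r} ≤ _ := fun j hj =>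
    h.listLaw_dist_smul_le hj (4 * r)
  have halign : ∀ j ≤ n, ∀ y, listLaw p j {l | r ≤ gromovProduct o y (l.prod • o)} ≤ _ :=
    fun j hj => h.listLaw_le_gromovProduct_le_of_le hX hδ hR hn hr0 hr hj
  set short := ENNReal.ofReal (A * lam ^ m * Real.exp (ε * (4 * r)))
  set backtrack := ENNReal.ofReal ((n + 1) * (A * Real.exp (-ε * (r / 2))))
  have hu : listLaw p n {l | dist o ((l.take a).prod • o) ≤ 4 * r} ≤ short :=
    (listLaw_take (by omega) {l | dist o (l.prod • o) ≤ 4 * r}).trans_le (hshort a hma)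
  have hv : listLaw p n {l | dist o (((l.drop (a + k)).take m).prod • o) ≤ 4 * r} ≤ short :=
    listLaw_take_drop_le_of_right (n := n - (a + k)) (by omega)
      (Q := fun _ l' => dist o ((l'.take m).prod • o) ≤ 4 * r) fun _ _ =>
      (listLaw_take (by omega) {l | dist o (l.prod • o) ≤ 4 * r}).trans_le (hshort m le_rfl)
  have hz : listLaw p n {l | dist o ((l.drop (a + k + m)).prod • o) ≤ 4 * r} ≤ short :=
    listLaw_take_drop_le_of_right (n := n - (a + k + m)) (by omega)
      (Q := fun _ l' => dist o (l'.prod • o) ≤ 4 * r) fun _ _ => hshort _ (by omega)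
  have hzu : listLaw p n {l | r ≤ gromovProduct o ((l.drop (a + k + m)).prod⁻¹ • o)
      ((l.take a).prod • o)} ≤ backtrack := by
    simp only [add_assoc a, ← List.drop_drop (i := k + m) (j := a)]
    exact listLaw_take_drop_le_of_left (n := n - a) (by omega)
      (Q := fun l l' => r ≤ gromovProduct o ((l'.drop (k + m)).prod⁻¹ • o) (l.prod • o)) fun _ =>
      halign a (by omega) _
  have hvz : listLaw p n {l | r ≤ gromovProduct o (((l.drop (a + k)).take m).prod⁻¹ • o)
      ((l.drop (a + k + m)).prod • o)} ≤ backtrack := by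
    simp only [List.take_drop]
    exact listLaw_take_drop_le_of_right (n := n - (a + k + m)) (by omega)
      (Q := fun l l' => r ≤ gromovProduct o ((l.drop (a + k)).prod⁻¹ • o) (l'.prod • o)) fun _ _ =>
      halign _ (by omega) _
  simp only [IsDegenerate, Set.ofPred_or]
  calc _ ≤ short + (short + (short + (backtrack + backtrack))) :=
        (measure_union_le _ _).trans (add_le_add hu <| (measure_union_le _ _).trans <|
          add_le_add hv <| (measure_union_le _ _).trans <| add_le_add hz <|
          (measure_union_le _ _).trans (add_le_add hzu hvz))
    _ = _ := by ring

lemma prod_eq_prod_take_mul_prod_drop (l : List G) (a k m : ℕ) :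
    l.prod = (l.take a).prod * ((l.drop a).take k).prod * ((l.drop (a + k)).take m).prod *
      (l.drop (a + k + m)).prod := by
  rw [← List.drop_drop (i := m), mul_assoc, List.prod_take_mul_prod_drop,
    ← List.drop_drop (i := k), mul_assoc, List.prod_take_mul_prod_drop,
    List.prod_take_mul_prod_drop]

/-- After `m` steps, `L` successive blocks of `m` steps each attempt an insertion in their first
`k` steps. The product is WPD unless all attempts fail or one of the cuts is degenerate. -/
lemma HasExpDecay.listLaw_not_isWPD_le (hX : IsGromovHyperbolic X)
    (hδ : FourPointCondition X δ) (hR : ∀ g ∈ p.support, dist o (g • o) ≤ R)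
    (h : HasExpDecay p o ε A lam) {n K : ℕ} (hn : n ≤ 2 ^ K) (hr0 : 0 ≤ r)
    (hr : K * δ + δ + R < r / 2) {Aligned : G → G → G → Prop}
    (hwpd : ∀ u g v z, Aligned u g v → ¬ IsDegenerate o r u v z → IsWPD X (u * g * v * z))
    {θ : ℝ≥0∞} {k : ℕ} (hθ : ∀ u v, listLaw p k {l | ¬ Aligned u l.prod v} ≤ θ) {m L : ℕ}
    (hkm : k ≤ m) (hnL : m + m * L + m ≤ n) :
    listLaw p n {l | ¬ IsWPD X l.prod} ≤
      θ ^ L + L * (3 * ENNReal.ofReal (A * lam ^ (m - k) * Real.exp (ε * (4 * r))) +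
        2 * ENNReal.ofReal ((n + 1) * (A * Real.exp (-ε * (r / 2))))) := by
  let Bad : List G → List G → Prop := fun l l' =>
    ¬ Aligned l.prod (l'.take k).prod (l'.drop k).prod
  let degenerate : ℕ → Set (List G) := fun i => {l | IsDegenerate o r (l.take (m + m * i)).prod
    ((l.drop (m + m * i + k)).take (m - k)).prod (l.drop (m + m * i + k + (m - k))).prod}
  have hcover : {l : List G | ¬ IsWPD X l.prod} ⊆
      {l | ∀ i < L, Bad (l.take (m + m * i)) ((l.drop (m + m * i)).take m)} ∪
        ⋃ i ∈ Finset.range L, degenerate i := by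
    refine fun l hl => or_iff_not_imp_right.2 fun hdeg i hi haligned => hl ?_
    rw [prod_eq_prod_take_mul_prod_drop l (m + m * i) k (m - k)]
    refine hwpd _ _ _ _ ?_ fun hi_deg => hdeg (Set.mem_biUnion (Finset.mem_range.2 hi) hi_deg)
    rwa [List.take_take, min_eq_left hkm, List.drop_take, List.drop_drop] at haligned
  have htrial : ∀ l, listLaw p m {l' | Bad l l'} ≤ θ := fun l =>
    listLaw_take_drop_le_of_left (Nat.add_sub_cancel' hkm).symm
      (Q := fun l₁ l₂ => ¬ Aligned l.prod l₁.prod l₂.prod) fun l' => hθ l.prod l'.prod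
  refine (measure_mono hcover).trans ((measure_union_le _ _).trans (add_le_add
    (listLaw_forall_trials_le htrial m L (by omega)) ((measure_biUnion_finset_le _ _).trans ?_)))
  refine (Finset.sum_le_card_nsmul _ _ _ fun i hi => ?_).trans_eq
    (by rw [Finset.card_range, nsmul_eq_mul])
  have hblock : m * (i + 1) ≤ m * L := Nat.mul_le_mul_left m (Finset.mem_range.1 hi)
  rw [Nat.mul_succ] at hblock
  exact h.listLaw_isDegenerate_le hX hδ hR hn hr0 hr (by omega) (by omega)

end Estimate

section Asymptotics

lemma eventually_exists_sq_le_two_pow {ρ δ : ℝ} (hρ : 0 < ρ) (hδ : 0 ≤ δ) (R : ℝ) :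
    ∀ᶠ m : ℕ in atTop, ∃ K : ℕ, (m + 1) ^ 2 ≤ 2 ^ K ∧ K * δ + δ + R < ρ * m / 2 := by
  have hlin : Tendsto (fun m : ℕ => (m : ℝ) + 1) atTop atTop :=
    tendsto_natCast_atTop_atTop.atTop_add tendsto_const_nhds
  have hlog : (fun m : ℕ => 2 * δ / Real.log 2 * Real.log (m + 1) + (2 * δ + R)) =o[atTop]
      fun m : ℕ => (m : ℝ) + 1 :=
    ((Real.isLittleO_log_id_atTop.comp_tendsto hlin).const_mul_left _).add
      (Asymptotics.isLittleO_const_left.2 (Or.inr (tendsto_norm_atTop_atTop.comp hlin)))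
  filter_upwards [hlog.bound (show 0 < ρ / 4 by positivity), eventually_ge_atTop 2] with m hm hm2
  refine ⟨Nat.clog 2 ((m + 1) ^ 2), Nat.le_pow_clog one_lt_two _, ?_⟩
  have hclog : (Nat.clog 2 ((m + 1) ^ 2) : ℝ) ≤ 2 * Real.log (m + 1) / Real.log 2 + 1 := by
    have hlogb : Real.logb 2 ((m + 1) ^ 2) = 2 * Real.log (m + 1) / Real.log 2 := by
      rw [Real.logb, Real.log_pow, Nat.cast_ofNat]
    have hnonneg : 0 ≤ Real.logb 2 (((m + 1) ^ 2 : ℕ) : ℝ) :=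
      Real.logb_nonneg one_lt_two (by exact_mod_cast Nat.one_le_pow _ _ m.succ_pos)
    have hceil := (Nat.ceil_lt_add_one hnonneg).le
    rw [← Nat.cast_ofNat (R := ℝ), Real.natCeil_logb_natCast] at hceil
    push_cast at hceil
    rwa [hlogb] at hceil
  have hm2' : (2 : ℝ) ≤ m := by exact_mod_cast hm2
  calc (Nat.clog 2 ((m + 1) ^ 2) : ℝ) * δ + δ + R
      ≤ (2 * Real.log (m + 1) / Real.log 2 + 1) * δ + δ + R := by gcongr
    _ = 2 * δ / Real.log 2 * Real.log (m + 1) + (2 * δ + R) := by ring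
    _ ≤ ρ / 4 * ‖(m : ℝ) + 1‖ := (Real.le_norm_self _).trans hm
    _ = ρ / 4 * (m + 1) := by rw [Real.norm_of_nonneg (by positivity)]
    _ < ρ * m / 2 := by nlinarith

lemma exists_cube_mul_pow_le {q : ℝ} (hq0 : 0 < q) (hq1 : q < 1) :
    ∃ B : ℝ, ∀ m : ℕ, ((m : ℝ) + 1) ^ 3 * q ^ m ≤ B := by
  obtain ⟨B, hB⟩ := (tendsto_pow_const_mul_const_pow_of_abs_lt_one 3
    (abs_lt.2 ⟨by linarith, hq1⟩)).bddAbove_range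
  refine ⟨B / q, fun m => (le_div_iff₀ hq0).2 ?_⟩
  rw [mul_assoc, ← pow_succ]
  exact_mod_cast hB ⟨m + 1, rfl⟩

lemma exists_exp_le_sq_pow {ε lam : ℝ} (hε : 0 < ε) (hlam0 : 0 < lam) (hlam1 : lam < 1) :
    ∃ ρ q : ℝ, 0 < ρ ∧ 0 < q ∧ q < 1 ∧ ∀ m : ℕ,
      lam ^ m * Real.exp (ε * (4 * (ρ * m))) ≤ (q ^ m) ^ 2 ∧
        Real.exp (-ε * (ρ * m / 2)) ≤ (q ^ m) ^ 2 := by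
  obtain ⟨t, rfl⟩ : ∃ t, Real.exp (-t) = lam :=
    ⟨-Real.log lam, by rw [neg_neg, Real.exp_log hlam0]⟩
  have ht : 0 < t := by simpa using hlam1
  refine ⟨t / (8 * ε), Real.exp (-(t / 32)), by positivity, Real.exp_pos _, by simpa using ht,
    fun m => ?_⟩
  simp only [← Real.exp_nat_mul, ← Real.exp_add, Real.exp_le_exp]
  push_cast
  have htm : 0 ≤ m * t := by positivity
  constructor
  · have : ε * (4 * (t / (8 * ε) * m)) = m * t / 2 := by field_simp; ring
    linarith
  · have : -ε * (t / (8 * ε) * m / 2) = -(m * t / 16) := by field_simp; ring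
    linarith

lemma exists_mul_add_le_mul_pow {ε A lam : ℝ} (hε : 0 < ε) (hA : 0 < A) (hlam0 : 0 < lam)
    (hlam1 : lam < 1) (k : ℕ) :
    ∃ ρ q B : ℝ, 0 < ρ ∧ 0 < q ∧ q < 1 ∧ 0 ≤ B ∧ ∀ m n : ℕ, k ≤ m → n < (m + 1) ^ 2 →
      m * (3 * (A * lam ^ (m - k) * Real.exp (ε * (4 * (ρ * m)))) +
        2 * ((n + 1) * (A * Real.exp (-ε * (ρ * m / 2))))) ≤ B * q ^ m := by
  obtain ⟨ρ, q, hρ, hq0, hq1, hdecay⟩ := exists_exp_le_sq_pow hε hlam0 hlam1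
  obtain ⟨B, hB⟩ := exists_cube_mul_pow_le hq0 hq1
  have hB0 : 0 ≤ B := le_trans (by positivity) (hB 0)
  refine ⟨ρ, q, (3 / lam ^ k + 2) * A * B, hρ, hq0, hq1, by positivity, fun m n hkm hn => ?_⟩
  obtain ⟨hshort, hbacktrack⟩ := hdecay m
  have hn' : (n : ℝ) + 1 ≤ (m + 1) ^ 2 := by exact_mod_cast hn
  have hone : (1 : ℝ) ≤ (m + 1) ^ 2 := one_le_pow₀ (by linarith [m.cast_nonneg (α := ℝ)])
  have hpow : lam ^ (m - k) = lam ^ m / lam ^ k := by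
    rw [eq_div_iff (pow_pos hlam0 k).ne', ← pow_add, Nat.sub_add_cancel hkm]
  calc _ = m * (3 / lam ^ k * A * (lam ^ m * Real.exp (ε * (4 * (ρ * m)))) * 1 +
        2 * ((n + 1) * (A * Real.exp (-ε * (ρ * m / 2))))) := by rw [hpow]; ring
    _ ≤ (m + 1) * (3 / lam ^ k * A * (q ^ m) ^ 2 * (m + 1) ^ 2 +
        2 * ((m + 1) ^ 2 * (A * (q ^ m) ^ 2))) := by
      gcongr
      exact le_add_of_nonneg_right zero_le_one
    _ = (3 / lam ^ k + 2) * A * ((m + 1) ^ 3 * q ^ m) * q ^ m := by ring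
    _ ≤ _ := by
      gcongr
      exact hB m

lemma pow_natSqrt_le {c : ℝ} (hc0 : 0 < c) (hc1 : c ≤ 1) (n : ℕ) :
    c ^ Nat.sqrt n ≤ c⁻¹ * c ^ Real.sqrt n := by
  rw [← Real.rpow_natCast, ← Real.rpow_neg_one, ← Real.rpow_add hc0]
  refine Real.rpow_le_rpow_of_exponent_ge hc0 hc1 ?_
  linarith [Real.real_sqrt_le_nat_sqrt_succ (a := n)]

lemma exists_le_rpow_sqrt {f : ℕ → ℝ≥0∞} (hf : ∀ n, f n ≤ 1) {B c : ℝ} (hB : 0 ≤ B)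
    (hc0 : 0 < c) (hc1 : c < 1)
    (h : ∀ᶠ m : ℕ in atTop, ∀ n, Nat.sqrt n = m → f n ≤ ENNReal.ofReal (B * c ^ m)) :
    ∃ B' : ℝ, 0 < B' ∧ ∀ n : ℕ, f n ≤ ENNReal.ofReal (B' * c ^ Real.sqrt n) := by
  obtain ⟨N, hN⟩ := eventually_atTop.1 h
  have hpow : ∀ n, f n ≤ ENNReal.ofReal ((B + (c ^ N)⁻¹) * c ^ Nat.sqrt n) := by
    intro n
    rcases le_or_gt N (Nat.sqrt n) with hn | hn
    · refine (hN _ hn n rfl).trans (ENNReal.ofReal_le_ofReal ?_)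
      gcongr
      exact le_add_of_nonneg_right (by positivity)
    · have hone : 1 ≤ (c ^ N)⁻¹ * c ^ Nat.sqrt n := by
        rw [← div_eq_inv_mul, one_le_div (by positivity)]
        exact pow_le_pow_of_le_one hc0.le hc1.le hn.le
      refine (hf n).trans (ENNReal.one_le_ofReal.2 ?_)
      rw [add_mul]
      exact le_add_of_nonneg_of_le (by positivity) hone
  refine ⟨(B + (c ^ N)⁻¹) * c⁻¹, by positivity, fun n =>
    (hpow n).trans (ENNReal.ofReal_le_ofReal ?_)⟩
  rw [mul_assoc]
  gcongr
  exact pow_natSqrt_le hc0 hc1.le n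

end Asymptotics

section Conclusion

variable {G : Type*} [Group G] {p : PMF G}

lemma schottkyElement_mem_support_prodLaw {a b : G} {ka kb : ℕ} (ha : a ∈ (prodLaw p ka).support)
    (hb : b ∈ (prodLaw p kb).support) (N e q : ℕ) (i : Fin N) :
    schottkyElement a b N e q i ∈ (prodLaw p (ka * (N * e) + kb * q)).support := by
  have hlength : ka * (i * e) + kb * q + ka * ((N - i) * e) = ka * (N * e) + kb * q := by
    rw [add_right_comm, ← mul_add, ← add_mul, Nat.add_sub_cancel' i.2.le]
  rw [← hlength]
  exact mul_mem_support_prodLaw (mul_mem_support_prodLaw (pow_mem_support_prodLaw ha (i * e))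
    (pow_mem_support_prodLaw hb q)) (pow_mem_support_prodLaw ha ((N - i) * e))

variable {X : Type*} [MetricSpace X] [MulAction G X] [IsIsometricSMul G X] {o : X} {R : ℝ}

/-- For `n` between `m ^ 2` and `(m + 1) ^ 2`, one uses `m - 2` blocks of length `m`, at a scale
proportional to `m`. -/
lemma HasExpDecay.eventually_listLaw_not_isWPD_le {δ ε A lam : ℝ} (hX : IsGromovHyperbolic X)
    (hδ : FourPointCondition X δ) (hR : ∀ g ∈ p.support, dist o (g • o) ≤ R)
    (h : HasExpDecay p o ε A lam) {Aligned : G → G → G → Prop} {r₀ : ℝ}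
    (hwpd : ∀ r ≥ r₀, ∀ u g v z, Aligned u g v → ¬ IsDegenerate o r u v z →
      IsWPD X (u * g * v * z))
    {θ : ℝ≥0∞} (hθ1 : θ < 1) {k : ℕ}
    (hθ : ∀ u v, listLaw p k {l | ¬ Aligned u l.prod v} ≤ θ) :
    ∃ B c : ℝ, 0 ≤ B ∧ 0 < c ∧ c < 1 ∧ ∀ᶠ m : ℕ in atTop, ∀ n, Nat.sqrt n = m →
      listLaw p n {l | ¬ IsWPD X l.prod} ≤ ENNReal.ofReal (B * c ^ m) := by
  obtain ⟨ρ, q, B, hρ, hq0, hq1, hB, herror⟩ := exists_mul_add_le_mul_pow h.rate_pos h.const_pos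
    h.base_pos h.base_lt_one k
  set c := max θ.toReal q
  have hc0 : 0 < c := lt_max_of_lt_right hq0
  have hc1 : c < 1 := max_lt (by simpa using ENNReal.toReal_lt_of_lt_ofReal (by simpa)) hq1
  have hθc : θ ≤ ENNReal.ofReal c := (ENNReal.le_ofReal_iff_toReal_le hθ1.ne_top hc0.le).2
    (le_max_left _ _)
  refine ⟨(c ^ 2)⁻¹ + B, c, by positivity, hc0, hc1, ?_⟩
  filter_upwards [eventually_exists_sq_le_two_pow hρ (hδ.nonneg o) R,
    (tendsto_natCast_atTop_atTop.const_mul_atTop hρ).eventually (eventually_ge_atTop r₀),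
    eventually_ge_atTop k, eventually_ge_atTop 2] with m ⟨K, hK, hKR⟩ hr₀ hkm hm2 n hnm
  have hn_lt : n < (m + 1) ^ 2 := by rw [← hnm, sq]; exact Nat.lt_succ_sqrt n
  have hn_ge : m * m ≤ n := hnm ▸ Nat.sqrt_le n
  have hblocks : m + m * (m - 2) + m = m * m := by
    obtain ⟨L, rfl⟩ := Nat.exists_eq_add_of_le' hm2
    rw [Nat.add_sub_cancel]
    ring
  have hA := h.const_pos
  have hlam := h.base_pos
  calc listLaw p n {l | ¬ IsWPD X l.prod}
      ≤ θ ^ (m - 2) + (m - 2 : ℕ) *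
          (3 * ENNReal.ofReal (A * lam ^ (m - k) * Real.exp (ε * (4 * (ρ * m)))) +
            2 * ENNReal.ofReal ((n + 1) * (A * Real.exp (-ε * (ρ * m / 2))))) :=
        h.listLaw_not_isWPD_le hX hδ hR (hn_lt.le.trans hK) (by positivity) hKR (hwpd _ hr₀) hθ
          hkm (hblocks.trans_le hn_ge)
    _ ≤ ENNReal.ofReal c ^ (m - 2) + ENNReal.ofReal (B * q ^ m) := by
        gcongr
        refine le_trans ?_ (ENNReal.ofReal_le_ofReal (herror m n hkm hn_lt))
        rw [ENNReal.ofReal_mul (Nat.cast_nonneg m), ENNReal.ofReal_natCast,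
          ENNReal.ofReal_add (by positivity) (by positivity),
          ENNReal.ofReal_mul (p := 3) zero_le_three, ENNReal.ofReal_mul (p := 2) zero_le_two,
          ENNReal.ofReal_ofNat, ENNReal.ofReal_ofNat]
        gcongr
        exact Nat.sub_le m 2
    _ ≤ ENNReal.ofReal ((c ^ 2)⁻¹ * c ^ m) + ENNReal.ofReal (B * c ^ m) := by
        rw [← ENNReal.ofReal_pow hc0.le, ← div_eq_inv_mul, pow_sub₀ c hc0.ne' hm2, div_eq_mul_inv]
        gcongr
        exact le_max_right _ _
    _ = _ := by rw [← ENNReal.ofReal_add (by positivity) (by positivity), add_mul]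

lemma exists_listLaw_not_isWPD_le (hX : IsGromovHyperbolic X)
    (hR : ∀ g ∈ p.support, dist o (g • o) ≤ R) {a b h : G}
    (ha : a ∈ Subsemigroup.closure p.support) (hb : b ∈ Subsemigroup.closure p.support)
    (hab : AreIndependentLoxodromic X a b) (hh : h ∈ Subsemigroup.closure p.support)
    (hwpd : IsWPD X h) :
    ∃ B c : ℝ, 0 < B ∧ 0 < c ∧ c < 1 ∧ ∀ n : ℕ,
      listLaw p n {l | ¬ IsWPD X l.prod} ≤ ENNReal.ofReal (B * c ^ Real.sqrt n) := by
  obtain ⟨δ, hδ⟩ := hX.exists_fourPointCondition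
  have hδ0 := hδ.nonneg o
  obtain ⟨e, C, hC, hschottky⟩ := hab.exists_isSchottky hδ o 12
  obtain ⟨q, D, hD, hs⟩ := hschottky (8 * C + 4 * δ + 2)
  obtain ⟨ka, hka⟩ := exists_mem_support_prodLaw ha
  obtain ⟨kb, hkb⟩ := exists_mem_support_prodLaw hb
  obtain ⟨kh, hkh⟩ := exists_mem_support_prodLaw hh
  have hmem := schottkyElement_mem_support_prodLaw hka hkb 12 e q
  obtain ⟨M, hfin, hM⟩ := hwpd.exists_pow hδ o (K := 2 * C + 10 * δ + 1) (by positivity)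
    (2 * C + 3 * δ + 1)
  obtain ⟨θ, hθ1, hθ⟩ := hs.exists_listLaw_not_isAlignedInsertion_le (H := h ^ M) (by simp)
    fun i j => mul_mem_support_prodLaw
      (mul_mem_support_prodLaw (hmem i) (pow_mem_support_prodLaw hkh M)) (hmem j)
  obtain ⟨N, hN, hdrift⟩ := hs.exists_edist_add_one_le_meanDist hδ hC hD (by simp) hmem hR
  obtain ⟨ε, A, lam, hdecay⟩ := exists_hasExpDecay hR hN hdrift
  obtain ⟨B, c, hB, hc0, hc1, hbound⟩ := hdecay.eventually_listLaw_not_isWPD_le hX hδ hR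
    (fun r hr u g v z => isWPD_of_isAlignedInsertion hδ hs hC (by linarith) hr hM hfin) hθ1 hθ
  obtain ⟨B', hB', hall⟩ := exists_le_rpow_sqrt (fun n => prob_le_one) hB hc0 hc1 hbound
  exact ⟨B', c, hB', hc0, hc1, hall⟩

end Conclusion

section Law

variable {G : Type*}

variable [MeasurableSpace G] {μ : Measure G}

lemma IsCountableMeasure.countable_atoms (h : IsCountableMeasure μ) : (atoms μ).Countable := by
  obtain ⟨S, hS, hSc⟩ := h
  refine hS.mono fun g hg => ?_
  by_contra hgS
  exact hg (measure_mono_null (Set.singleton_subset_iff.2 hgS) hSc)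

lemma IsCountableMeasure.measure_compl_atoms (h : IsCountableMeasure μ) : μ (atoms μ)ᶜ = 0 := by
  obtain ⟨S, hS, hSc⟩ := h
  have hdiff : μ (⋃ g ∈ S \ atoms μ, {g}) = 0 :=
    (measure_biUnion_null_iff (hS.mono Set.sdiff_subset)).2 fun g hg => not_not.1 hg.2
  rw [Set.biUnion_of_singleton] at hdiff
  refine measure_mono_null (fun g hg => ?_) (measure_union_null hSc hdiff)
  exact (em (g ∈ S)).elim (fun hgS => Or.inr ⟨hgS, hg⟩) Or.inl

variable [IsProbabilityMeasure μ]

instance : IsProbabilityMeasure (stepLaw μ) :=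
  inferInstanceAs (IsProbabilityMeasure (Measure.infinitePi _))

lemma IsCountableMeasure.ae_stepLaw_mem_atoms (h : IsCountableMeasure μ) :
    ∀ᵐ ω ∂stepLaw μ, ∀ i, ω i ∈ atoms μ :=
  ae_all_iff.2 fun i => (measurePreserving_eval_infinitePi (fun _ : ℕ => μ) i)
    |>.quasiMeasurePreserving.ae h.measure_compl_atoms

variable [MeasurableSingletonClass G]

lemma IsCountableMeasure.tsum_singleton (h : IsCountableMeasure μ) : ∑' g, μ {g} = 1 := by
  have hc := h.countable_atoms
  calc ∑' g, μ {g} = ∑' g : atoms μ, μ {(g : G)} :=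
        (tsum_subtype_eq_of_support_subset (f := fun g => μ {g}) fun g hg => hg).symm
    _ = μ (⋃ g ∈ atoms μ, {g}) :=
        (measure_biUnion hc (fun a _ b _ hab => Set.disjoint_singleton.2 hab)
          fun g _ => measurableSet_singleton g).symm
    _ = 1 := by
        rw [Set.biUnion_of_singleton, prob_compl_eq_zero_iff hc.measurableSet |>.1
          h.measure_compl_atoms]

/-- The probability mass function of a countable probability measure. Mathlib's `Measure.toPMF`
requires the whole space to be countable. -/
def IsCountableMeasure.pmf (h : IsCountableMeasure μ) : PMF G :=
  ⟨fun g => μ {g}, h.tsum_singleton ▸ ENNReal.summable.hasSum⟩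

lemma stepLaw_map_range_eq (f : ℕ → G) (n : ℕ) :
    stepLaw μ {ω | (List.range n).map ω = (List.range n).map f} =
      ((List.range n).map fun i => μ {f i}).prod := by
  have hpi : {ω : ℕ → G | (List.range n).map ω = (List.range n).map f} =
      Set.pi (Finset.range n) fun i => {f i} := by
    ext ω
    simp
  rw [hpi, stepLaw, Measure.infinitePi_pi _ fun i _ => measurableSet_singleton (f i)]
  rfl

lemma IsCountableMeasure.stepLaw_map_range_eq_steps (h : IsCountableMeasure μ)
    {n : ℕ} {l : List G} (hl : l.length = n) :
    stepLaw μ {ω | (List.range n).map ω = l} = steps h.pmf n l := by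
  obtain ⟨g₀⟩ := μ.nonempty_of_neZero
  obtain ⟨f, rfl⟩ : ∃ f : ℕ → G, (List.range n).map f = l :=
    ⟨fun i => l.getD i g₀, List.ext_getElem (by simp [hl]) fun i hi hi' => by simp [hi']⟩
  rw [stepLaw_map_range_eq]
  conv_rhs => enter [1]; rw [← hl]
  rw [steps_length_apply, List.map_map]
  rfl

lemma IsCountableMeasure.stepLaw_map_range_mem_le (h : IsCountableMeasure μ) (n : ℕ)
    (A : Set (List G)) :
    stepLaw μ {ω | (List.range n).map ω ∈ A} ≤ listLaw h.pmf n A := by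
  set S := A ∩ (steps h.pmf n).support
  have hS : S.Countable := (steps h.pmf n).support_countable.mono Set.inter_subset_right
  calc stepLaw μ {ω | (List.range n).map ω ∈ A}
      ≤ stepLaw μ (⋃ l ∈ S, {ω | (List.range n).map ω = l}) := by
        refine measure_mono_ae (h.ae_stepLaw_mem_atoms.mono fun ω hω hA => ?_)
        refine Set.mem_biUnion ⟨hA, mem_support_steps.2 ⟨by simp, ?_⟩⟩ rfl
        exact List.forall_mem_map.2 fun i _ => hω i
    _ ≤ ∑' l : S, stepLaw μ {ω | (List.range n).map ω = l} := measure_biUnion_le _ hS _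
    _ = ∑' l : S, steps h.pmf n l := tsum_congr fun l =>
        h.stepLaw_map_range_eq_steps (mem_support_steps.1 l.2.2).1
    _ = listLaw h.pmf n S := by
        rw [tsum_subtype, listLaw, PMF.toMeasure_apply_eq_tsum]
    _ ≤ listLaw h.pmf n A := measure_mono Set.inter_subset_left

end Law

section Walk

variable {G : Type*} [Group G]

variable [MeasurableSpace G] [MeasurableSingletonClass G] {μ : Measure G}
  [IsProbabilityMeasure μ]

lemma IsCountableMeasure.one_sub_le_stepLaw_real_walk (h : IsCountableMeasure μ) {n : ℕ}
    {P : G → Prop} {c : ℝ} (hc : 0 ≤ c)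
    (hP : listLaw h.pmf n {l | ¬ P l.prod} ≤ ENNReal.ofReal c) :
    1 - c ≤ (stepLaw μ).real {ω | P (walk ω n)} := by
  have hcompl : (stepLaw μ).real {ω | P (walk ω n)}ᶜ ≤ c := by
    refine ENNReal.toReal_le_of_le_ofReal hc ((le_of_eq ?_).trans
      ((h.stepLaw_map_range_mem_le n {l | ¬ P l.prod}).trans hP))
    simp only [walk_eq_prod_map_range]
    rfl
  have hunion := measureReal_union_le (μ := stepLaw μ) {ω | P (walk ω n)} {ω | P (walk ω n)}ᶜ
  rw [Set.union_compl_self, probReal_univ] at hunion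
  linarith

end Walk

end WPD

end

theorem mainTheorem8 {G : Type*} [Group G] [MeasurableSpace G] [MeasurableSingletonClass G]
    {X : Type*} [MetricSpace X] [MulAction G X] [IsIsometricSMul G X]
    (hX : WPD.IsGromovHyperbolic X)
    (μ : MeasureTheory.Measure G) [MeasureTheory.IsProbabilityMeasure μ]
    (hcount : WPD.IsCountableMeasure μ)
    (hne : WPD.IsNonElementary X μ)
    (hbdd : WPD.IsBoundedMeasure X μ)
    (hwpd : WPD.IsWPDMeasure X μ) :
    ∃ B c : ℝ, 0 < B ∧ 0 < c ∧ c < 1 ∧ ∀ n : ℕ,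
      1 - B * c ^ Real.sqrt (n : ℝ) ≤
        (WPD.stepLaw μ).real {ω : ℕ → G | WPD.IsWPD X (WPD.walk ω n)} := by
  obtain ⟨a, ha, b, hb, hab⟩ := hne
  obtain ⟨h, hh, hhwpd⟩ := hwpd
  obtain ⟨o, ho⟩ := hbdd
  obtain ⟨R, hR⟩ := (Metric.isBounded_iff_subset_closedBall o).1 ho
  have hdist : ∀ g ∈ hcount.pmf.support, dist o (g • o) ≤ R := fun g hg =>
    Metric.mem_closedBall'.1 (hR (Set.mem_image_of_mem _ hg))
  obtain ⟨B, c, hB, hc0, hc1, hbound⟩ := WPD.exists_listLaw_not_isWPD_le hX hdist ha hb hab hh hhwpd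
  exact ⟨B, c, hB, hc0, hc1, fun n =>
    hcount.one_sub_le_stepLaw_real_walk (by positivity) (hbound n)⟩
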